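/- Let $R=(E,(\rho_i)_{i\in I})$ be a relational structure: a set $E$ with a family of finitary relations $\rho_i$ on $E$. For $A\subseteq E$ write $R|_A$ for the induced structure on $A$. A *monomorphic decomposition* of $R$ is a partition of $E$ into blocks such that $R|_A\cong R|_{A'}$ for all finite $A,A'\subseteq E$ with $|A\cap B|=|A'\cap B|$ for every block $B$. It is *minimal* if it is the coarsest one, i.e. every monomorphic decomposition of $R$ refines it. It is *recursively minimal* if it is minimal and, for every set $S$ of infinite blocks, the blocks in $S$ form the minimal monomorphic decomposition of $R|_{\bigcup S}$. The *age algebra* $\mathbb{Q}\mathcal{A}(R)$ consists of the (possibly infinite) rational linear combinations of finite subsets of $E$ that have bounded degree (the cardinalities of the subsets that occur are bounded) and in which the coefficient of $A$ depends only on the isomorphism type of $R|_A$. The product extends $A\cdot B=A\cup B$ if $A\cap B=\emptyset$ and $A\cdot B=0$ otherwise. When $R$ has finitely many isomorphism types of $n$-element restrictions for each $n$ (as is the case below), the orbit sums $m_\tau=\sum_{R|_A\in\tau}A$, for $\tau$ an isomorphism type of finite restrictions of $R$, form a basis. **Theorem.** Suppose that $R$ has a monomorphic decomposition with finitely many blocks.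 Then $R$ has a (necessarily unique) minimal monomorphic decomposition $P$, it has finitely many blocks, and the $\mathbb{Q}$-algebra $\mathbb{Q}\mathcal{A}(R)$ is finitely generated if and only if $P$ is recursively minimal. In that case, let $k$ be the number of infinite blocks of $P$; for integers $D,j\ge 1$ let $\theta_j^{(D)}\in\mathbb{Q}\mathcal{A}(R)$ be the sum of all finite sets $A\subseteq E$ such that $R|_A$ is isomorphic to $R|_{A'}$ for some $A'$ that has exactly $D$ elements in each of $j$ distinct infinite blocks of $P$ and no other elements (the analogue of the elementary symmetric polynomial $e_j(x_1^D,\dots,x_k^D)$ with one variable for each infinite block). Then for some $D\ge1$ the elements $\theta_1^{(D)},\dots,\theta_k^{(D)}$ are algebraically independent over $\mathbb{Q}$, and $\mathbb{Q}\mathcal{A}(R)$ is a finitely generated module over the subalgebra $\mathbb{Q}[\theta_1^{(D)},\dots,\theta_k^{(D)}]$. -/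

import Mathlib

noncomputable section

/-! ### Relational structures and their restrictions

A relational structure `R = (E, (ρ_i)_{i ∈ I})` is a structure `E` for a relational first-order
language `L` (the relation symbols are the indices, sorted by arity). -/

namespace AgeAlg

open scoped FirstOrder

universe u v w

section Structures

variable (L : FirstOrder.Language.{u, v}) [L.IsRelational] {E : Type w} [L.Structure E]

/-- The restriction of the relational structure `E` to the subset `A`. -/
def restr (A : Set E) : L.Substructure E where
  carrier := A
  fun_mem := fun f => isEmptyElim f

/-- The restrictions of the structure to `A` and to `B` are isomorphic. -/
def IsoOn (A B : Set E) : Prop := Nonempty (restr L A ≃[L] restr L B)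

theorem IsoOn.symm {A B : Set E} (h : IsoOn L A B) : IsoOn L B A := h.map fun e => e.symm

theorem IsoOn.trans {A B C : Set E} (h : IsoOn L A B) (h' : IsoOn L B C) : IsoOn L A C := by
  obtain ⟨e⟩ := h
  obtain ⟨e'⟩ := h'
  exact ⟨e'.comp e⟩

theorem IsoOn.card_eq {A B : Finset E} (h : IsoOn L (A : Set E) B) : A.card = B.card := by
  obtain ⟨e⟩ := h
  exact Finset.card_eq_of_equiv (s := A) (t := B) e.toEquiv

/-- A partition of `E` (given by its equivalence relation) is a monomorphic decomposition if the
restrictions to two finite subsets are isomorphic as soon as these subsets have as many elements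
as each other in every block. -/
def IsMonomorphicDecomposition (P : Setoid E) : Prop :=
  ∀ A A' : Finset E, (∀ B ∈ P.classes, ((A : Set E) ∩ B).ncard = ((A' : Set E) ∩ B).ncard) →
    IsoOn L (A : Set E) A'

/-- The minimal (that is, coarsest) monomorphic decomposition: every monomorphic decomposition
refines it. -/
def IsMinimalDecomposition (P : Setoid E) : Prop :=
  IsMonomorphicDecomposition L P ∧ ∀ Q : Setoid E, IsMonomorphicDecomposition L Q → Q ≤ P

/-- The infinite blocks of a partition. -/
def infiniteBlocks (P : Setoid E) : Set (Set E) := {B ∈ P.classes | B.Infinite}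

/-- A monomorphic decomposition is recursively minimal if it is minimal and if, for each set `S` of
infinite blocks, the blocks in `S` form the minimal monomorphic decomposition of the restriction of
the structure to their union. -/
def IsRecursivelyMinimal (P : Setoid E) : Prop :=
  IsMinimalDecomposition L P ∧
    ∀ S ⊆ infiniteBlocks P,
      IsMinimalDecomposition L (E := restr L (⋃₀ S)) (P.comap Subtype.val)

end Structures

/-! ### The algebra of sets

`SetAlgebra E` consists of the formal linear combinations, possibly infinite, of finite subsets of
`E` (encoded by their coefficients), with the bilinear product for which `A * B = A ∪ B` if `A`
and `B` are disjoint and `A * B = 0` otherwise. -/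

/-- Formal linear combinations of finite subsets of `E`. -/
def SetAlgebra (E : Type w) : Type w := Finset E → ℚ

namespace SetAlgebra

variable {E : Type w}

instance : AddCommGroup (SetAlgebra E) := inferInstanceAs (AddCommGroup (Finset E → ℚ))
instance : Module ℚ (SetAlgebra E) := inferInstanceAs (Module ℚ (Finset E → ℚ))

/-- The coefficient of the finite set `A`. -/
def coeff (f : SetAlgebra E) (A : Finset E) : ℚ := f A

@[ext] theorem ext {f g : SetAlgebra E} (h : ∀ A, f.coeff A = g.coeff A) : f = g := funext h

open Classical in
instance : Mul (SetAlgebra E) :=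
  ⟨fun f g => fun A => ∑ B ∈ A.powerset, f.coeff B * g.coeff (A \ B)⟩

open Classical in
instance : One (SetAlgebra E) := ⟨fun A => if A = ∅ then 1 else 0⟩

@[simp] theorem coeff_add (f g : SetAlgebra E) (A : Finset E) :
    (f + g).coeff A = f.coeff A + g.coeff A := rfl

@[simp] theorem coeff_zero (A : Finset E) : (0 : SetAlgebra E).coeff A = 0 := rfl

@[simp] theorem coeff_smul (c : ℚ) (f : SetAlgebra E) (A : Finset E) :
    (c • f).coeff A = c * f.coeff A := rfl

open Classical in
theorem coeff_mul (f g : SetAlgebra E) (A : Finset E) :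
    (f * g).coeff A = ∑ B ∈ A.powerset, f.coeff B * g.coeff (A \ B) := rfl

open Classical in
theorem coeff_one (A : Finset E) : (1 : SetAlgebra E).coeff A = if A = ∅ then 1 else 0 := rfl

protected theorem mul_comm (f g : SetAlgebra E) : f * g = g * f := by
  classical
  ext A
  rw [coeff_mul, coeff_mul]
  refine Finset.sum_bij' (fun B _ => A \ B) (fun B _ => A \ B) ?_ ?_ ?_ ?_ ?_
  · intro B _; simp
  · intro B _; simp
  · intro B hB; simp [Finset.inter_eq_right.mpr (Finset.mem_powerset.mp hB)]
  · intro B hB; simp [Finset.inter_eq_right.mpr (Finset.mem_powerset.mp hB)]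
  · intro B hB
    rw [mul_comm]
    simp [Finset.inter_eq_right.mpr (Finset.mem_powerset.mp hB)]

protected theorem one_mul (f : SetAlgebra E) : 1 * f = f := by
  classical
  ext A
  rw [coeff_mul, Finset.sum_eq_single ∅]
  · simp [coeff_one]
  · intro B _ hB; simp [coeff_one, hB]
  · simp

protected theorem mul_assoc (f g h : SetAlgebra E) : f * g * h = f * (g * h) := by
  classical
  ext A
  simp only [coeff_mul, Finset.sum_mul, Finset.mul_sum]
  rw [Finset.sum_sigma', Finset.sum_sigma']
  refine Finset.sum_bij' (fun p _ => ⟨p.2, p.1 \ p.2⟩) (fun p _ => ⟨p.1 ∪ p.2, p.1⟩)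
    ?_ ?_ ?_ ?_ ?_
  · rintro ⟨B, C⟩ hp
    simp only [Finset.mem_sigma, Finset.mem_powerset] at hp ⊢
    exact ⟨hp.2.trans hp.1, Finset.sdiff_subset_sdiff hp.1 le_rfl⟩
  · rintro ⟨B, C⟩ hp
    simp only [Finset.mem_sigma, Finset.mem_powerset] at hp ⊢
    exact ⟨Finset.union_subset hp.1 (hp.2.trans Finset.sdiff_subset), Finset.subset_union_left⟩
  · rintro ⟨B, C⟩ hp
    simp only [Finset.mem_sigma, Finset.mem_powerset] at hp
    simp [Finset.union_sdiff_of_subset hp.2]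
  · rintro ⟨B, C⟩ hp
    simp only [Finset.mem_sigma, Finset.mem_powerset] at hp
    have : Disjoint C B := Finset.disjoint_of_subset_left hp.2 Finset.sdiff_disjoint
    simp [Finset.union_sdiff_cancel_left this.symm]
  · rintro ⟨B, C⟩ hp
    simp only [Finset.mem_sigma, Finset.mem_powerset] at hp
    have h1 : (A \ C) \ (B \ C) = A \ B := by
      ext x
      have := @hp.2 x
      simp only [Finset.mem_sdiff]
      tauto
    simp only [h1, mul_assoc]

instance : CommRing (SetAlgebra E) :=
  { (inferInstance : AddCommGroup (SetAlgebra E)),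
    (inferInstance : Mul (SetAlgebra E)),
    (inferInstance : One (SetAlgebra E)) with
    mul_assoc := SetAlgebra.mul_assoc
    mul_comm := SetAlgebra.mul_comm
    one_mul := SetAlgebra.one_mul
    mul_one := fun f => by rw [SetAlgebra.mul_comm, SetAlgebra.one_mul]
    left_distrib := fun f g h => by
      ext A; simp [coeff_mul, mul_add, Finset.sum_add_distrib]
    right_distrib := fun f g h => by
      ext A; simp [coeff_mul, add_mul, Finset.sum_add_distrib]
    zero_mul := fun f => by ext A; simp [coeff_mul]
    mul_zero := fun f => by ext A; simp [coeff_mul] }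

instance : Algebra ℚ (SetAlgebra E) :=
  Algebra.ofModule
    (fun r f g => by ext A; simp [coeff_mul, Finset.mul_sum, mul_assoc])
    (fun r f g => by ext A; simp [coeff_mul, Finset.mul_sum, mul_left_comm])

end SetAlgebra

/-! ### The age algebra -/

section Age

variable (L : FirstOrder.Language.{u, v}) [L.IsRelational] (E : Type w) [L.Structure E]

/-- An isomorphism between two restrictions induces a bijection between the subsets, which
respects isomorphism types and complements. -/
theorem exists_image_of_isoOn {A A' : Finset E} (h : IsoOn L (A : Set E) A') :
    ∃ φ : Finset E → Finset E, ∀ B ⊆ A, φ B ⊆ A' ∧ IsoOn L (B : Set E) (φ B) ∧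
      (∀ C ⊆ A, φ B = φ C → B = C) ∧
      (∀ C : Finset E, (∀ x, x ∈ C ↔ x ∈ A ∧ x ∉ B) →
        ∀ x, x ∈ φ C ↔ x ∈ A' ∧ x ∉ φ B) := by
  classical
  obtain ⟨e⟩ := h
  let g : E → E := fun x => if hx : x ∈ A then (e ⟨x, hx⟩ : E) else x
  have g_mem : ∀ x ∈ A, g x ∈ A' := fun x hx => by
    simp only [g, dif_pos hx]; exact (e ⟨x, hx⟩).2
  have g_eq : ∀ x (hx : x ∈ A), g x = (e ⟨x, hx⟩ : E) := fun x hx => by simp only [g, dif_pos hx]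
  have g_inj : ∀ x ∈ A, ∀ y ∈ A, g x = g y → x = y := by
    intro x hx y hy hxy
    rw [g_eq x hx, g_eq y hy] at hxy
    exact congrArg Subtype.val (e.injective (Subtype.ext hxy))
  have g_surj : ∀ y ∈ A', ∃ x ∈ A, g x = y := by
    intro y hy
    obtain ⟨⟨x, hx⟩, hxy⟩ := e.surjective ⟨y, hy⟩
    exact ⟨x, hx, by rw [g_eq x hx, hxy]⟩
  refine ⟨fun B => B.image g, fun B hB => ⟨?_, ?_, ?_, ?_⟩⟩
  · intro y hy
    obtain ⟨x, hx, rfl⟩ := Finset.mem_image.mp hy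
    exact g_mem x (hB hx)
  · have hbij : Function.Bijective
        (fun x : restr L (B : Set E) =>
          (⟨g x, Finset.mem_coe.mpr (Finset.mem_image_of_mem g x.2)⟩ :
            restr L ((B.image g : Finset E) : Set E))) := by
      constructor
      · intro x y hxy
        exact Subtype.ext (g_inj x (hB x.2) y (hB y.2) (congrArg Subtype.val hxy))
      · rintro ⟨y, hy⟩
        obtain ⟨x, hx, rfl⟩ := Finset.mem_image.mp (Finset.mem_coe.mp hy)
        exact ⟨⟨x, hx⟩, rfl⟩
    refine ⟨⟨Equiv.ofBijective _ hbij, fun f _ => isEmptyElim f, ?_⟩⟩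
    intro n r v
    have key := e.map_rel r (fun i => (⟨v i, hB (v i).2⟩ : restr L (A : Set E)))
    have hv : (fun i => g (v i)) = fun i => ((e ⟨v i, hB (v i).2⟩ : _) : E) :=
      funext fun i => g_eq _ (hB (v i).2)
    change FirstOrder.Language.Structure.RelMap r (fun i => g (v i)) ↔
      FirstOrder.Language.Structure.RelMap r (fun i => ((v i : _) : E))
    rw [hv]
    exact key
  · intro C hC hBC
    replace hBC : B.image g = C.image g := hBC
    ext x
    constructor
    · intro hx
      obtain ⟨y, hy, hyx⟩ := Finset.mem_image.mp (hBC ▸ Finset.mem_image_of_mem g hx)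
      exact g_inj y (hC hy) x (hB hx) hyx ▸ hy
    · intro hx
      obtain ⟨y, hy, hyx⟩ := Finset.mem_image.mp (hBC.symm ▸ Finset.mem_image_of_mem g hx)
      exact g_inj y (hB hy) x (hC hx) hyx ▸ hy
  · intro C hC y
    simp only [Finset.mem_image]
    constructor
    · rintro ⟨x, hx, rfl⟩
      have hx' := (hC x).mp hx
      refine ⟨g_mem x hx'.1, ?_⟩
      rintro ⟨z, hz, hzx⟩
      exact hx'.2 (g_inj z (hB hz) x hx'.1 hzx ▸ hz)
    · rintro ⟨hy, hyB⟩
      obtain ⟨x, hx, rfl⟩ := g_surj y hy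
      exact ⟨x, (hC x).mpr ⟨hx, fun hxB => hyB ⟨x, hxB, rfl⟩⟩, rfl⟩

/-- The age algebra of the relational structure `E` over `ℚ`: the linear combinations of finite
subsets which have bounded degree and whose coefficients only depend on the isomorphism type of
the restriction. When the profile is finite (in particular, if there is a finite monomorphic
decomposition) the orbit sums of the isomorphism types form a basis of it. -/
def ageAlgebra : Subalgebra ℚ (SetAlgebra E) where
  carrier := {f | (∃ n : ℕ, ∀ A, f.coeff A ≠ 0 → A.card ≤ n) ∧
    ∀ A A' : Finset E, IsoOn L (A : Set E) A' → f.coeff A = f.coeff A'}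
  mul_mem' := by
    classical
    rintro f g ⟨⟨n, hn⟩, hf⟩ ⟨⟨m, hm⟩, hg⟩
    refine ⟨⟨n + m, fun A hA => ?_⟩, fun A A' h => ?_⟩
    · rw [SetAlgebra.coeff_mul] at hA
      obtain ⟨B, hB, hne⟩ := Finset.exists_ne_zero_of_sum_ne_zero hA
      have h1 := hn B (left_ne_zero_of_mul hne)
      have h2 := hm _ (right_ne_zero_of_mul hne)
      have h3 := Finset.card_sdiff_add_card_eq_card (Finset.mem_powerset.mp hB)
      omega
    · obtain ⟨φ, hφ⟩ := exists_image_of_isoOn L E h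
      have hmaps : ∀ B ∈ A.powerset, φ B ∈ A'.powerset := fun B hB =>
        Finset.mem_powerset.mpr (hφ B (Finset.mem_powerset.mp hB)).1
      have hinj : ∀ B ∈ A.powerset, ∀ C ∈ A.powerset, φ B = φ C → B = C := fun B hB C hC =>
        (hφ B (Finset.mem_powerset.mp hB)).2.2.1 C (Finset.mem_powerset.mp hC)
      have hsurj := Finset.surj_on_of_inj_on_of_card_le (s := A.powerset) (t := A'.powerset)
        (fun B _ => φ B) hmaps (fun B C hB hC => hinj B hB C hC)
        (by rw [Finset.card_powerset, Finset.card_powerset, h.card_eq])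
      rw [SetAlgebra.coeff_mul, SetAlgebra.coeff_mul]
      refine Finset.sum_bij (fun B _ => φ B) hmaps (fun B hB C hC => hinj B hB C hC)
        (fun C hC => ?_) (fun B hB => ?_)
      · obtain ⟨B, hB, hBC⟩ := hsurj C hC
        exact ⟨B, hB, hBC.symm⟩
      · have hBA := Finset.mem_powerset.mp hB
        have hc : φ (A \ B) = A' \ φ B := by
          ext x
          rw [(hφ B hBA).2.2.2 (A \ B) (fun x => Finset.mem_sdiff) x, Finset.mem_sdiff]
        rw [hf B _ (hφ B hBA).2.1, hg (A \ B) _ (hφ (A \ B) Finset.sdiff_subset).2.1, hc]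
  add_mem' := by
    rintro f g ⟨⟨n, hn⟩, hf⟩ ⟨⟨m, hm⟩, hg⟩
    refine ⟨⟨n + m, fun A hA => ?_⟩, fun A A' h => ?_⟩
    · by_cases h0 : f.coeff A = 0
      · have := hm A (by simpa [h0] using hA)
        omega
      · have := hn A h0
        omega
    · rw [SetAlgebra.coeff_add, SetAlgebra.coeff_add, hf A A' h, hg A A' h]
  algebraMap_mem' := by
    classical
    intro r
    rw [Algebra.algebraMap_eq_smul_one]
    refine ⟨⟨0, fun A hA => ?_⟩, fun A A' h => ?_⟩
    · by_contra hne
      have hne' : A ≠ ∅ := by rintro rfl; simp at hne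
      exact hA (by rw [SetAlgebra.coeff_smul, SetAlgebra.coeff_one, if_neg hne', mul_zero])
    · have := h.card_eq
      have h' : A = ∅ ↔ A' = ∅ := by rw [← Finset.card_eq_zero, this, Finset.card_eq_zero]
      simp only [SetAlgebra.coeff_smul, SetAlgebra.coeff_one, h']

/-! ### The analogues of the elementary symmetric polynomials -/

variable {E}

/-- `A` has exactly `D` elements in each of `j` distinct infinite blocks of the partition `P`, and
no other elements. -/
def IsUniform (P : Setoid E) (D j : ℕ) (A : Finset E) : Prop :=
  ∃ S : Finset (Set E), ↑S ⊆ infiniteBlocks P ∧ S.card = j ∧ (A : Set E) ⊆ ⋃₀ (S : Set (Set E)) ∧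
    ∀ B ∈ S, ((A : Set E) ∩ B).ncard = D

theorem IsUniform.card_le {P : Setoid E} {D j : ℕ} {A : Finset E} (h : IsUniform P D j A) :
    A.card ≤ j * D := by
  classical
  obtain ⟨S, -, rfl, hA, hD⟩ := h
  have hsub : A ⊆ S.biUnion fun B => A.filter (· ∈ B) := by
    intro x hx
    obtain ⟨B, hB, hxB⟩ := hA hx
    exact Finset.mem_biUnion.mpr ⟨B, hB, Finset.mem_filter.mpr ⟨hx, hxB⟩⟩
  refine (Finset.card_le_card hsub).trans (Finset.card_biUnion_le_card_mul _ _ _ fun B hB => ?_)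
  rw [← hD B hB, ← Set.ncard_coe_finset]
  exact le_of_eq (congrArg Set.ncard (by ext; simp))

open Classical in
/-- The sum of all finite sets `A` whose restriction is isomorphic to the restriction to a set with
exactly `D` elements in each of `j` infinite blocks: the analogue in the age algebra of the `j`-th
elementary symmetric polynomial in the `D`-th powers of the variables, where there is one variable
for each infinite block. -/
def elementary (P : Setoid E) (D j : ℕ) : ageAlgebra L E :=
  ⟨fun A => if ∃ A' : Finset E, IsoOn L (A : Set E) A' ∧ IsUniform P D j A' then 1 else 0, by
    refine ⟨⟨j * D, fun A hA => ?_⟩, fun A A' h => ?_⟩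
    · have hA' : ∃ A' : Finset E, IsoOn L (A : Set E) A' ∧ IsUniform P D j A' := by
        by_contra hne
        exact hA (if_neg hne)
      obtain ⟨A', h, hu⟩ := hA'
      exact h.card_eq.le.trans hu.card_le
    · exact if_congr ⟨fun ⟨B, hB, hu⟩ => ⟨B, (h.symm).trans L hB, hu⟩,
        fun ⟨B, hB, hu⟩ => ⟨B, h.trans L hB, hu⟩⟩ rfl rfl⟩

/-- The subalgebra of the age algebra generated by the analogues of the elementary symmetric
polynomials of orders `1, …, k`, where `k` is the number of infinite blocks of `P`. -/
def symSubalgebra (P : Setoid E) (D : ℕ) : Subalgebra ℚ (ageAlgebra L E) :=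
  Algebra.adjoin ℚ
    (Set.range fun j : Fin (infiniteBlocks P).ncard => elementary L P D (j + 1))

end Age

end AgeAlg

end

noncomputable section

namespace AgeAlg

open scoped FirstOrder

universe u v w

/-! ### Interchangeable elements, the minimal decomposition, and the choice of `D` -/

section Structures

variable (L : FirstOrder.Language.{u, v}) [L.IsRelational] {E : Type w} [L.Structure E]

/-! Call two elements interchangeable if either can replace the other in any finite set without
changing the isomorphism type. This is an equivalence relation, and a partition is a monomorphic
decomposition exactly when its equivalent elements are interchangeable. So interchangeability is the
coarsest decomposition `P`, and it has finitely many blocks as soon as some decomposition has.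

The bridge to algebra is `blockHom`, which sends the variable of a block to the sum of its
singletons. For disjoint blocks the monomial with exponents `a` goes to `∏ (a B)!` times the sum of
the sets with `a B` elements in each `B`, so coefficients with respect to divided powers
(`divCoeff`) are coefficients at sets. Every element of the age algebra is thus a polynomial in the
block sums. On infinite blocks the polynomial is unique; finite blocks contribute only nilpotents.

Sufficiency. If `P` is recursively minimal, distinct blocks of any set of infinite blocks are told
apart by a finite set inside their union. If `D` exceeds the sizes of these witnesses, a set
isomorphic to a uniform one has at most `D` elements in each block
(`IsRecursivelyMinimal.exists_ncard_inter_le`). The polynomials of the `θ_j` then have the monomials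
of `e_j` in the `D`-th powers as dominant terms, and a valuation argument makes all variables
integral over them (`isIntegral_X_of_dominant`). Algebraic independence follows by counting
transcendence degree. Module finiteness follows because the age algebra lies in a finite module over
a Noetherian ring.

Necessity. If `P` is not recursively minimal, two blocks `b ≠ c` in a set `S` of infinite blocks
have elements that are interchangeable inside `⋃₀ S` but not in `E`. For `U` outside `⋃₀ S` let `T U
f` be the polynomial of the coefficients of `f` at the sets `A ∪ U` with `A ⊆ ⋃₀ S`, and let `δ =
∂/∂b - ∂/∂c`. Then `δ` kills every `T ∅ f`. For a minimal `U` with `δ ∘ T U ≠ 0`, this composite is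
a derivation over `T ∅`, so finite generation yields one `N` with `δ^(N+1) (T U f) = 0` for all `f`.
For an orbit sum the divided-power coefficients along a line in direction `b - c` are `0` or `1`,
and vanishing `(N+1)`-st differences make them constant on long lines. But multiplying by powers of
the sum of the singletons, whose image under `T ∅` is a constant for `δ`, produces an arbitrarily
long line on which the isomorphism type changes. -/

theorem IsoOn.refl (A : Set E) : IsoOn L A A := ⟨FirstOrder.Language.Equiv.refl L _⟩

variable {L} in
/-- An isomorphism between restrictions extends to a map which induces isomorphisms between the
restrictions to all smaller subsets. -/
theorem IsoOn.exists_bijOn {A B : Set E} (h : IsoOn L A B) :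
    ∃ g : E → E, Set.BijOn g A B ∧ ∀ C ⊆ A, IsoOn L C (g '' C) := by
  classical
  obtain ⟨e⟩ := h
  let g : E → E := fun x => if hx : x ∈ A then (e ⟨x, hx⟩ : E) else x
  have g_eq : ∀ x (hx : x ∈ A), g x = (e ⟨x, hx⟩ : E) := fun x hx => by simp only [g, dif_pos hx]
  have g_inj : Set.InjOn g A := by
    intro x hx y hy hxy
    rw [g_eq x hx, g_eq y hy] at hxy
    exact congrArg Subtype.val (e.injective (Subtype.ext hxy))
  refine ⟨g, ⟨fun x hx => ?_, g_inj, fun y hy => ?_⟩, fun C hC => ?_⟩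
  · rw [g_eq x hx]; exact (e ⟨x, hx⟩).2
  · obtain ⟨⟨x, hx⟩, hxy⟩ := e.surjective ⟨y, hy⟩
    exact ⟨x, hx, by rw [g_eq x hx, hxy]⟩
  · let e' : restr L C ≃ restr L (g '' C) := Equiv.Set.imageOfInjOn g C (g_inj.mono hC)
    refine ⟨⟨e', fun f _ => isEmptyElim f, ?_⟩⟩
    intro n r v
    have key := e.map_rel r (fun i => (⟨v i, hC (v i).2⟩ : restr L A))
    have hv : (fun i => g (v i)) = fun i => ((e ⟨v i, hC (v i).2⟩ : _) : E) :=
      funext fun i => g_eq _ (hC (v i).2)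
    change FirstOrder.Language.Structure.RelMap r (fun i => g (v i)) ↔
      FirstOrder.Language.Structure.RelMap r (fun i => ((v i : _) : E))
    rw [hv]
    exact key

theorem nonempty_restr_equiv_image {X : Set E} (A : Set (restr L X)) :
    Nonempty (restr L A ≃[L] restr L ((Subtype.val : restr L X → E) '' A)) := by
  let e : restr L A ≃ restr L ((Subtype.val : restr L X → E) '' A) :=
    Equiv.Set.image (Subtype.val : restr L X → E) A Subtype.val_injective
  exact ⟨⟨e, fun f _ => isEmptyElim f, fun r v => Iff.rfl⟩⟩

theorem isoOn_restr_iff {X : Set E} (A A' : Set (restr L X)) :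
    IsoOn L A A' ↔ IsoOn L ((Subtype.val : restr L X → E) '' A)
      ((Subtype.val : restr L X → E) '' A') := by
  obtain ⟨e⟩ := nonempty_restr_equiv_image L A
  obtain ⟨e'⟩ := nonempty_restr_equiv_image L A'
  constructor
  · rintro ⟨f⟩
    exact ⟨(e'.comp f).comp e.symm⟩
  · rintro ⟨f⟩
    exact ⟨(e'.symm.comp f).comp e⟩

/-- Two elements are interchangeable if they can be exchanged in every finite subset which contains
exactly one of them, without changing the isomorphism type. -/
def Interchangeable (x y : E) : Prop :=
  ∀ A : Finset E, x ∉ A → y ∉ A → IsoOn L (insert x (A : Set E)) (insert y (A : Set E))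

/-- The partition of `E` into classes of interchangeable elements. -/
def interchangeSetoid (E : Type w) [L.Structure E] : Setoid E where
  r := Interchangeable L
  iseqv := by
    classical
    refine ⟨fun x A _ _ => IsoOn.refl L _, fun h A hx hy => (h A hy hx).symm, ?_⟩
    intro x y z hxy hyz A hx hz
    -- If `A = A₀ ∪ {y}`, the two exchanges have to avoid `y`: replace `y` by `z` over `A₀ ∪ {x}`,
    -- then `x` by `y` over `A₀ ∪ {z}`.
    by_cases hy : y ∈ A
    · by_cases hxz : x = z
      · subst hxz; exact IsoOn.refl L _
      have hxy' : x ≠ y := fun h => hx (h ▸ hy)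
      have hzy : z ≠ y := fun h => hz (h ▸ hy)
      have h1 := hyz (insert x (A.erase y)) (by simp [Ne.symm hxy'])
        (by simp [Ne.symm hxz, hz])
      have h2 := hxy (insert z (A.erase y)) (by simp [hxz, hx]) (by simp [Ne.symm hzy])
      have e1 : insert x (A : Set E) = insert y ((insert x (A.erase y) : Finset E) : Set E) := by
        ext t; simp; by_cases t = y <;> simp_all
      have e2 : insert z ((insert x (A.erase y) : Finset E) : Set E) =
          insert x ((insert z (A.erase y) : Finset E) : Set E) := by
        ext t; simp; tauto
      have e3 : insert y ((insert z (A.erase y) : Finset E) : Set E) = insert z (A : Set E) := by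
        ext t; simp; by_cases t = y <;> simp_all
      rw [e1, ← e3]
      exact h1.trans L (e2 ▸ h2)
    · exact (hxy A hx hy).trans L (hyz A hy hz)

variable {L}

theorem ncard_inter_insert_of_mem {A : Finset E} {B : Set E} {x : E} (hx : x ∉ A) (hB : x ∈ B) :
    (insert x (A : Set E) ∩ B).ncard = ((A : Set E) ∩ B).ncard + 1 := by
  rw [Set.insert_inter_of_mem hB, Set.ncard_insert_of_notMem (by simp [hx])
    (A.finite_toSet.inter_of_left B)]

theorem ncard_inter_insert_of_notMem {A : Set E} {B : Set E} {x : E} (hB : x ∉ B) :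
    (insert x A ∩ B).ncard = (A ∩ B).ncard := by
  rw [Set.insert_inter_of_notMem hB]

theorem mem_classes_iff_of_rel {P : Setoid E} {B : Set E} (hB : B ∈ P.classes) {x y : E}
    (hxy : P x y) : x ∈ B ↔ y ∈ B := by
  obtain ⟨z, rfl⟩ := hB
  exact ⟨fun h => P.trans (P.symm hxy) h, fun h => P.trans hxy h⟩

theorem rel_of_mem_classes {P : Setoid E} {B : Set E} (hB : B ∈ P.classes) {x y : E}
    (hx : x ∈ B) (hy : y ∈ B) : P x y := by
  obtain ⟨z, rfl⟩ := hB
  exact P.trans hx (P.symm hy)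

theorem IsMonomorphicDecomposition.interchangeable {P : Setoid E}
    (hP : IsMonomorphicDecomposition L P) {x y : E} (hxy : P x y) : Interchangeable L x y := by
  classical
  intro A hx hy
  rw [← Finset.coe_insert, ← Finset.coe_insert]
  refine hP _ _ fun B hB => ?_
  rw [Finset.coe_insert, Finset.coe_insert]
  by_cases hxB : x ∈ B
  · rw [ncard_inter_insert_of_mem hx hxB,
      ncard_inter_insert_of_mem hy ((mem_classes_iff_of_rel hB hxy).mp hxB)]
  · rw [ncard_inter_insert_of_notMem hxB,
      ncard_inter_insert_of_notMem fun h => hxB ((mem_classes_iff_of_rel hB hxy).mpr h)]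

/-- Equal block counts allow `A` to be turned into `A'` one exchange at a time: an element of `A \
A'` is replaced by an element of `A' \ A` in the same block, which lowers the cardinality of `A \
A'`. -/
theorem isMonomorphicDecomposition_of_interchangeable {P : Setoid E}
    (hP : ∀ x y, P x y → Interchangeable L x y) : IsMonomorphicDecomposition L P := by
  classical
  intro A A'
  induction h : (A \ A').card generalizing A with
  | zero =>
    intro hB
    have hsub : A ⊆ A' := by
      rwa [Finset.card_eq_zero, Finset.sdiff_eq_empty_iff_subset] at h
    have : A = A' := by
      refine Finset.Subset.antisymm hsub fun x hx => ?_
      have h1 := hB {y | P y x} ⟨x, rfl⟩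
      have h2 := Set.eq_of_subset_of_ncard_le
        (Set.inter_subset_inter_left {y | P y x} (Finset.coe_subset.mpr hsub))
        h1.ge (A'.finite_toSet.inter_of_left _)
      have h3 : x ∈ (A' : Set E) ∩ {y | P y x} :=
        ⟨hx, P.refl x⟩
      rw [← h2] at h3
      exact h3.1
    rw [this]
    exact IsoOn.refl L _
  | succ n ih =>
    intro hB
    obtain ⟨x, hx⟩ : (A \ A').Nonempty := Finset.card_pos.mp (by omega)
    obtain ⟨hxA, hxA'⟩ := Finset.mem_sdiff.mp hx
    let C : Set E := {y | P y x}
    have hC : C ∈ P.classes := ⟨x, rfl⟩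
    have hxC : x ∈ C := P.refl x
    obtain ⟨y, ⟨hyA', hyC⟩, hyA⟩ : ∃ y ∈ (A' : Set E) ∩ C, y ∉ (A : Set E) := by
      by_contra! hcon
      have h1 : (A' : Set E) ∩ C ⊆ (A : Set E) ∩ C := fun y hy => ⟨hcon y hy, hy.2⟩
      have h2 := Set.eq_of_subset_of_ncard_le h1 (hB C hC).le (A.finite_toSet.inter_of_left _)
      have h3 : x ∈ (A : Set E) ∩ C := ⟨hxA, hxC⟩
      rw [← h2] at h3
      exact hxA' h3.1
    have hA : A = insert x (A.erase x) := (Finset.insert_erase hxA).symm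
    have hyx : y ∉ A.erase x := fun h => hyA (Finset.mem_of_mem_erase h)
    have hiso : IsoOn L (A : Set E) ((insert y (A.erase x) : Finset E) : Set E) := by
      rw [hA, Finset.coe_insert, Finset.coe_insert, Finset.erase_insert (by simp)]
      exact hP _ _ (P.symm hyC) _ (by simp) hyx
    refine hiso.trans L (ih _ ?_ fun B hBc => ?_)
    · rw [Finset.insert_sdiff_of_mem _ hyA', Finset.erase_sdiff_comm, Finset.card_erase_of_mem hx, h]
      rfl
    · rw [← hB B hBc]
      have hiff := mem_classes_iff_of_rel hBc hyC
      conv_rhs => rw [hA]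
      rw [Finset.coe_insert, Finset.coe_insert]
      by_cases hxB : x ∈ B
      · rw [ncard_inter_insert_of_mem hyx (hiff.mpr hxB), ncard_inter_insert_of_mem (by simp) hxB]
      · rw [ncard_inter_insert_of_notMem (mt hiff.mp hxB), ncard_inter_insert_of_notMem hxB]

variable (L) in
theorem isMonomorphicDecomposition_interchangeSetoid (E : Type w) [L.Structure E] :
    IsMonomorphicDecomposition L (interchangeSetoid L E) :=
  isMonomorphicDecomposition_of_interchangeable fun _ _ h => h

variable (L) in
-- The minimal decomposition exists for every structure and is explicit, because equivalent elements
-- of any monomorphic decomposition are interchangeable.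
theorem isMinimalDecomposition_interchangeSetoid (E : Type w) [L.Structure E] :
    IsMinimalDecomposition L (interchangeSetoid L E) :=
  ⟨isMonomorphicDecomposition_interchangeSetoid L E, fun _ hQ _ _ h => hQ.interchangeable h⟩

/-- In the restriction to a subset, interchangeability can be tested in the whole structure. -/
theorem interchangeable_restr_iff {X : Set E} (x y : restr L X) :
    Interchangeable L x y ↔ ∀ A : Finset E, (A : Set E) ⊆ X → (x : E) ∉ A → (y : E) ∉ A →
      IsoOn L (insert (x : E) (A : Set E)) (insert (y : E) (A : Set E)) := by
  classical
  constructor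
  · intro h A hAX hx hy
    let A' : Finset (restr L X) := A.preimage Subtype.val Subtype.val_injective.injOn
    have h1 := h A' (by simpa [A'] using hx) (by simpa [A'] using hy)
    rw [isoOn_restr_iff, Set.image_insert_eq, Set.image_insert_eq] at h1
    have h2 : (Subtype.val : restr L X → E) '' (A' : Set (restr L X)) = A := by
      ext t
      constructor
      · rintro ⟨s, hs, rfl⟩; simpa [A'] using hs
      · intro ht; exact ⟨⟨t, hAX ht⟩, by simpa [A'] using ht, rfl⟩
    rwa [h2] at h1
  · intro h A hx hy
    rw [isoOn_restr_iff, Set.image_insert_eq, Set.image_insert_eq]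
    have h1 := h (A.image Subtype.val) ?_ ?_ ?_
    · rwa [Finset.coe_image] at h1
    · rw [Finset.coe_image]
      rintro _ ⟨s, -, rfl⟩
      exact s.2
    · simpa using hx
    · simpa using hy

theorem IsMonomorphicDecomposition.comap_restr {P : Setoid E}
    (hP : IsMonomorphicDecomposition L P) (X : Set E) :
    IsMonomorphicDecomposition L (E := restr L X) (P.comap Subtype.val) :=
  isMonomorphicDecomposition_of_interchangeable fun x y hxy =>
    (interchangeable_restr_iff x y).mpr fun _ _ hx hy => hP.interchangeable hxy _ hx hy

theorem eq_of_mem_of_mem_classes {P : Setoid E} {B C : Set E} (hB : B ∈ P.classes)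
    (hC : C ∈ P.classes) {x : E} (hxB : x ∈ B) (hxC : x ∈ C) : B = C :=
  Setoid.eq_of_mem_classes hB hxB hC hxC

theorem infiniteBlocks_subset_classes (P : Setoid E) : infiniteBlocks P ⊆ P.classes :=
  fun _ h => h.1

/-- One can choose a finite set with prescribed numbers of elements in the blocks. -/
theorem exists_finset_ncard_inter {P : Setoid E} {S : Set (Set E)} (hS : S ⊆ P.classes)
    (hfin : S.Finite) (A : Set E) (n : Set E → ℕ) (hn : ∀ B ∈ S, (n B : ℕ∞) ≤ (A ∩ B).encard) :
    ∃ V : Finset E, (V : Set E) ⊆ A ∧ (V : Set E) ⊆ ⋃₀ S ∧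
      ∀ B ∈ S, ((V : Set E) ∩ B).ncard = n B := by
  classical
  have h1 : ∀ B : Set E, ∃ t : Finset E, B ∈ S → (t : Set E) ⊆ A ∩ B ∧ t.card = n B := by
    intro B
    by_cases hB : B ∈ S
    · obtain ⟨t, ht, hcard⟩ := Set.exists_subset_encard_eq (hn B hB)
      have htf : t.Finite := Set.finite_of_encard_eq_coe hcard
      refine ⟨htf.toFinset, fun _ => ⟨by simpa using ht, ?_⟩⟩
      rw [htf.encard_eq_coe_toFinset_card] at hcard
      exact_mod_cast hcard
    · exact ⟨∅, fun h => absurd h hB⟩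
  choose t ht using h1
  have hmem : ∀ x, x ∈ hfin.toFinset.biUnion t ↔ ∃ B ∈ S, x ∈ t B := by simp
  refine ⟨hfin.toFinset.biUnion t, fun x hx => ?_, fun x hx => ?_, fun B hB => ?_⟩
  · obtain ⟨B, hB, hxB⟩ := (hmem x).mp hx
    exact ((ht B hB).1 hxB).1
  · obtain ⟨B, hB, hxB⟩ := (hmem x).mp hx
    exact ⟨B, hB, ((ht B hB).1 hxB).2⟩
  · rw [← (ht B hB).2, ← Set.ncard_coe_finset]
    congr 1
    ext x
    constructor
    · rintro ⟨hx, hxB⟩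
      obtain ⟨C, hC, hxC⟩ := (hmem x).mp hx
      rwa [eq_of_mem_of_mem_classes (hS hB) (hS hC) hxB ((ht C hC).1 hxC).2]
    · intro hx
      exact ⟨(hmem x).mpr ⟨B, hB, hx⟩, ((ht B hB).1 hx).2⟩

/-- Two finite subsets of a union of blocks are isomorphic if they have the same numbers of elements
in these blocks. -/
theorem IsMonomorphicDecomposition.isoOn_of_subset {P : Setoid E}
    (hP : IsMonomorphicDecomposition L P) {S : Set (Set E)} (hS : S ⊆ P.classes) {A A' : Finset E}
    (hA : (A : Set E) ⊆ ⋃₀ S) (hA' : (A' : Set E) ⊆ ⋃₀ S)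
    (h : ∀ B ∈ S, ((A : Set E) ∩ B).ncard = ((A' : Set E) ∩ B).ncard) :
    IsoOn L (A : Set E) A' := by
  refine hP A A' fun B hB => ?_
  by_cases hBS : B ∈ S
  · exact h B hBS
  · have key : ∀ A : Finset E, (A : Set E) ⊆ ⋃₀ S → (A : Set E) ∩ B = ∅ := by
      intro A hA
      rw [Set.eq_empty_iff_forall_notMem]
      rintro x ⟨hxA, hxB⟩
      obtain ⟨C, hC, hxC⟩ := hA hxA
      exact hBS (eq_of_mem_of_mem_classes hB (hS hC) hxB hxC ▸ hC)
    rw [key A hA, key A' hA']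

/-- Interchangeability inside `⋃₀ S` is itself a decomposition of that restriction, so by minimality
it cannot link two blocks of `S`. The point is that the witness `W` lies inside `⋃₀ S`. -/
theorem IsRecursivelyMinimal.exists_not_isoOn {P : Setoid E} (h : IsRecursivelyMinimal L P)
    {S : Set (Set E)} (hS : S ⊆ infiniteBlocks P) {B C : Set E} (hB : B ∈ S) (hC : C ∈ S)
    (hBC : B ≠ C) :
    ∃ W : Finset E, ∃ x ∈ B, ∃ y ∈ C, (W : Set E) ⊆ ⋃₀ S ∧ x ∉ W ∧ y ∉ W ∧
      ¬ IsoOn L (insert x (W : Set E)) (insert y (W : Set E)) := by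
  obtain ⟨x, hx⟩ := (hS hB).2.nonempty
  obtain ⟨y, hy⟩ := (hS hC).2.nonempty
  have hxy : ¬ P x y := fun hxy => hBC (eq_of_mem_of_mem_classes (hS hB).1 (hS hC).1
    ((mem_classes_iff_of_rel (hS hB).1 hxy).mp hx) hy)
  let x' : restr L (⋃₀ S) := ⟨x, B, hB, hx⟩
  let y' : restr L (⋃₀ S) := ⟨y, C, hC, hy⟩
  have hxy' : ¬ Interchangeable L x' y' := fun hi => hxy
    ((h.2 S hS).2 _ (isMonomorphicDecomposition_interchangeSetoid L (restr L (⋃₀ S))) hi)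
  rw [interchangeable_restr_iff] at hxy'
  push Not at hxy'
  obtain ⟨W, hW, hxW, hyW, hiso⟩ := hxy'
  exact ⟨W, x, hx, y, hy, hW, hxW, hyW, hiso⟩

/-- Restricting `P` always gives a monomorphic decomposition, so only coarseness can fail: some
decomposition of the restriction to `⋃₀ S` merges elements of two blocks. -/
theorem IsMinimalDecomposition.exists_of_not_isRecursivelyMinimal {P : Setoid E}
    (h : IsMinimalDecomposition L P) (h' : ¬ IsRecursivelyMinimal L P) :
    ∃ S ⊆ infiniteBlocks P, ∃ B ∈ S, ∃ C ∈ S, ∃ x ∈ B, ∃ y ∈ C, ¬ P x y ∧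
      ∀ A : Finset E, (A : Set E) ⊆ ⋃₀ S → x ∉ A → y ∉ A →
        IsoOn L (insert x (A : Set E)) (insert y (A : Set E)) := by
  unfold IsRecursivelyMinimal at h'
  push Not at h'
  obtain ⟨S, hS, hmin⟩ := h' h
  unfold IsMinimalDecomposition at hmin
  push Not at hmin
  obtain ⟨Q, hQ, hle⟩ := hmin (h.1.comap_restr _)
  have : ∃ x y : restr L (⋃₀ S), Q x y ∧ ¬ P x y := by
    by_contra! hcon
    exact hle fun x y hxy => hcon x y hxy
  obtain ⟨⟨x, B, hB, hx⟩, ⟨y, C, hC, hy⟩, hxy, hPxy⟩ := this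
  exact ⟨S, hS, B, hB, C, hC, x, hx, y, hy, hPxy,
    (interchangeable_restr_iff _ _).mp (hQ.interchangeable hxy)⟩

theorem finite_classes (P : Setoid E) [Finite (Quotient P)] : P.classes.Finite :=
  by
  have : Finite P.classes := Finite.of_equiv _ (Setoid.quotientEquivClasses P)
  exact P.classes.toFinite

/-- If `P` is recursively minimal, then for some `D` a set isomorphic to a uniform set has at most
`D` elements in every block. -/
theorem IsRecursivelyMinimal.exists_ncard_inter_le {P : Setoid E} [Finite (Quotient P)]
    (h : IsRecursivelyMinimal L P) :
    ∃ D : ℕ, 1 ≤ D ∧ ∀ (j : ℕ) (A A' : Finset E), IsoOn L (A : Set E) A' → IsUniform P D j A' →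
      ∀ B ∈ P.classes, ((A : Set E) ∩ B).ncard ≤ D := by
  classical
  have hfin : (infiniteBlocks P).Finite := (finite_classes P).subset (infiniteBlocks_subset_classes P)
  have key : ∀ p : {S // S ⊆ infiniteBlocks P} × infiniteBlocks P × infiniteBlocks P, ∃ n : ℕ,
      p.2.1.1 ∈ p.1.1 → p.2.2.1 ∈ p.1.1 → p.2.1.1 ≠ p.2.2.1 →
      ∃ W : Finset E, W.card ≤ n ∧ ∃ x ∈ p.2.1.1, ∃ y ∈ p.2.2.1, (W : Set E) ⊆ ⋃₀ p.1.1 ∧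
        x ∉ W ∧ y ∉ W ∧ ¬ IsoOn L (insert x (W : Set E)) (insert y (W : Set E)) := by
    rintro ⟨⟨S, hS⟩, B, C⟩
    by_cases hc : B.1 ∈ S ∧ C.1 ∈ S ∧ B.1 ≠ C.1
    · obtain ⟨W, hW⟩ := h.exists_not_isoOn hS hc.1 hc.2.1 hc.2.2
      exact ⟨W.card, fun _ _ _ => ⟨W, le_rfl, hW⟩⟩
    · exact ⟨0, fun h1 h2 h3 => absurd ⟨h1, h2, h3⟩ hc⟩
  choose n hn using key
  have : Finite (infiniteBlocks P) := hfin
  have : Finite {S // S ⊆ infiniteBlocks P} := hfin.finite_subsets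
  obtain ⟨N, hN⟩ := (Set.finite_range n).bddAbove
  -- `N` bounds the sizes of the witnesses. One more element per block is needed because one point
  -- of a block may be set aside below.
  refine ⟨N + 1, by omega, ?_⟩
  rintro j A A' hAA' ⟨S, hS, -, hA', hcard⟩ B₀ hB₀
  by_contra! hlt
  obtain ⟨g, hg, hgiso⟩ := hAA'.exists_bijOn
  have hgB : g '' ((A : Set E) ∩ B₀) ⊆ A' := (Set.image_mono Set.inter_subset_left).trans
    hg.image_eq.subset
  have hncard : (g '' ((A : Set E) ∩ B₀)).ncard = ((A : Set E) ∩ B₀).ncard :=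
    (hg.injOn.mono Set.inter_subset_left).ncard_image
  -- More than `D` elements of one block cannot be mapped into a single block of `S`, which holds
  -- only `D` elements of `A'`. So two interchangeable elements `p`, `q` land in different blocks.
  obtain ⟨p, hp, q, hq, B, hB, C, hC, hpB, hqC, hBC⟩ : ∃ p ∈ (A : Set E) ∩ B₀,
      ∃ q ∈ (A : Set E) ∩ B₀, ∃ B ∈ S, ∃ C ∈ S, g p ∈ B ∧ g q ∈ C ∧ B ≠ C := by
    by_contra! hcon
    obtain ⟨p, hp⟩ : ((A : Set E) ∩ B₀).Nonempty := by
      rw [← Set.ncard_pos (A.finite_toSet.inter_of_left B₀)]; omega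
    obtain ⟨B, hB, hpB⟩ := hA' (hgB ⟨p, hp, rfl⟩)
    have hsub : g '' ((A : Set E) ∩ B₀) ⊆ (A' : Set E) ∩ B := by
      rintro _ ⟨q, hq, rfl⟩
      obtain ⟨C, hC, hqC⟩ := hA' (hgB ⟨q, hq, rfl⟩)
      refine ⟨hgB ⟨q, hq, rfl⟩, ?_⟩
      rw [hcon p hp q hq B hB C hC hpB hqC]
      exact hqC
    have := Set.ncard_le_ncard hsub (A'.finite_toSet.inter_of_left B)
    rw [hncard, hcard B hB] at this
    omega
  have hBc := (hS hB).1
  have hCc := (hS hC).1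
  obtain ⟨W, hWcard, x, hx, y, hy, hWS, hxW, hyW, hniso⟩ :=
    hn ⟨⟨S, hS⟩, ⟨B, hS hB⟩, ⟨C, hS hC⟩⟩ hB hC hBC
  have hWN : W.card ≤ N := hWcard.trans (hN ⟨_, rfl⟩)
  have hgpC : g p ∉ C := fun hc => hBC (eq_of_mem_of_mem_classes hBc hCc hpB hc)
  have hgqB : g q ∉ B := fun hc => hBC (eq_of_mem_of_mem_classes hBc hCc hc hqC)
  -- `V` is a copy of the witness `W` inside `A'`, avoiding `g p` and `g q`. These lie in different
  -- blocks, so each block of `S` keeps at least `D - 1 = N` elements.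
  obtain ⟨V, hVA, hVS, hVcard⟩ := exists_finset_ncard_inter (P := P) (S := S)
    (fun T hT => (hS hT).1) S.finite_toSet ((A' : Set E) \ {g p, g q})
    (fun T => ((W : Set E) ∩ T).ncard) (by
      intro T hT
      have h1 : ((W : Set E) ∩ T).ncard ≤ N := by
        refine (Set.ncard_le_ncard Set.inter_subset_left W.finite_toSet).trans ?_
        rwa [Set.ncard_coe_finset]
      have h2 : ∃ r, (A' : Set E) ∩ T ⊆ insert r (((A' : Set E) \ {g p, g q}) ∩ T) := by
        by_cases hpT : g p ∈ T
        · refine ⟨g p, fun z hz => ?_⟩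
          by_cases hzp : z = g p
          · exact Or.inl hzp
          · refine Or.inr ⟨⟨hz.1, ?_⟩, hz.2⟩
            rintro (hz' | hz')
            · exact hzp hz'
            · rw [Set.mem_singleton_iff] at hz'
              subst hz'
              exact hgqB (eq_of_mem_of_mem_classes hBc (hS hT).1 hpB hpT ▸ hz.2)
        · refine ⟨g q, fun z hz => ?_⟩
          by_cases hzq : z = g q
          · exact Or.inl hzq
          · refine Or.inr ⟨⟨hz.1, ?_⟩, hz.2⟩
            rintro (hz' | hz')
            · exact hpT (hz' ▸ hz.2)
            · exact hzq hz'
      obtain ⟨r, hr⟩ := h2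
      have hf : (((A' : Set E) \ {g p, g q}) ∩ T).Finite :=
        (A'.finite_toSet.subset Set.sdiff_subset).inter_of_left T
      have h3 := (Set.ncard_le_ncard hr (hf.insert r)).trans (Set.ncard_insert_le _ _)
      rw [hcard T hT] at h3
      rw [← hf.cast_ncard_eq]
      exact_mod_cast h1.trans (by omega))
  have hgpV : g p ∉ V := fun hc => (hVA hc).2 (by simp)
  have hgqV : g q ∉ V := fun hc => (hVA hc).2 (by simp)
  have hgpS : g p ∈ ⋃₀ (S : Set (Set E)) := ⟨B, hB, hpB⟩
  have hgqS : g q ∈ ⋃₀ (S : Set (Set E)) := ⟨C, hC, hqC⟩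
  -- transport to `W`
  have hmove : ∀ (T : Set E), T ∈ S → ∀ u ∈ T, ∀ v ∈ T, u ∉ V → v ∉ W →
      IsoOn L (insert u (V : Set E)) (insert v (W : Set E)) := by
    intro T hT u hu v hv huV hvW
    rw [← Finset.coe_insert, ← Finset.coe_insert]
    refine h.1.1.isoOn_of_subset (S := S) (fun T hT => (hS hT).1) ?_ ?_ fun T' hT' => ?_
    · rw [Finset.coe_insert]; exact Set.insert_subset ⟨T, hT, hu⟩ hVS
    · rw [Finset.coe_insert]; exact Set.insert_subset ⟨T, hT, hv⟩ hWS
    · rw [Finset.coe_insert, Finset.coe_insert]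
      have huv := rel_of_mem_classes (hS hT).1 hu hv
      have hiff := mem_classes_iff_of_rel (hS hT').1 huv
      by_cases huT : u ∈ T'
      · rw [ncard_inter_insert_of_mem huV huT, ncard_inter_insert_of_mem hvW (hiff.mp huT),
          hVcard T' hT']
      · rw [ncard_inter_insert_of_notMem huT, ncard_inter_insert_of_notMem (mt hiff.mpr huT),
          hVcard T' hT']
  -- pull back to `A`
  let V₀ : Finset E := A.filter (g · ∈ V)
  have hV₀ : g '' (V₀ : Set E) = V := by
    ext z
    constructor
    · rintro ⟨w, hw, rfl⟩; exact (Finset.mem_filter.mp hw).2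
    · intro hz
      obtain ⟨w, hw, rfl⟩ := hg.surjOn (hVA hz).1
      exact ⟨w, Finset.mem_coe.mpr (Finset.mem_filter.mpr ⟨hw, hz⟩), rfl⟩
  have hV₀A : (V₀ : Set E) ⊆ A := fun w hw => (Finset.mem_filter.mp hw).1
  have hpV₀ : p ∉ V₀ := fun hc => hgpV (Finset.mem_filter.mp hc).2
  have hqV₀ : q ∉ V₀ := fun hc => hgqV (Finset.mem_filter.mp hc).2
  have h1 := hgiso (insert p V₀) (Set.insert_subset hp.1 hV₀A)
  have h2 := hgiso (insert q V₀) (Set.insert_subset hq.1 hV₀A)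
  rw [Set.image_insert_eq, hV₀] at h1 h2
  have h3 := h.1.1.interchangeable (rel_of_mem_classes hB₀ hp.2 hq.2) V₀ hpV₀ hqV₀
  have h4 : IsoOn L (insert (g p) (V : Set E)) (insert (g q) (V : Set E)) :=
    (h1.symm).trans L (h3.trans L h2)
  exact hniso (((hmove B hB _ hpB x hx hgpV hxW).symm).trans L
    (h4.trans L (hmove C hC _ hqC y hy hgqV hyW)))

end Structures

/-! ### Integrality over polynomials that resemble elementary symmetric ones -/

section Valuations

open MvPolynomial

variable {σ : Type*} [Fintype σ]

theorem valuation_algebraMap_rat {K : Type*} [Field K] [Algebra ℚ K] (V : ValuationSubring K)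
    (hV : ∀ c : ℚ, algebraMap ℚ K c ∈ V) {c : ℚ} (hc : c ≠ 0) :
    V.valuation (algebraMap ℚ K c) = 1 := by
  have h1 := (V.valuation_le_one_iff _).mpr (hV c)
  have h2 := (V.valuation_le_one_iff _).mpr (hV c⁻¹)
  rw [map_inv₀, map_inv₀] at h2
  refine le_antisymm h1 ?_
  have h0 : V.valuation (algebraMap ℚ K c) ≠ 0 := by
    rw [Ne, map_eq_zero, map_eq_zero]
    exact hc
  rwa [inv_le_one₀ (zero_lt_iff.mpr h0)] at h2

/-- Among the monomials of degree `|T| * D` with exponents at most `D`, the monomial with exponent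
`D` at all elements of `T` is the dominant one, if `T` is the set of the large variables. -/
theorem prod_pow_lt_prod_pow {Γ : Type*} [LinearOrderedCommGroupWithZero Γ] {D : ℕ} {w : σ → Γ}
    (hw : ∀ i, w i ≠ 0) {a b : σ →₀ ℕ} (ha : ∀ i, a i ≤ D) (hab : ∑ i, a i = ∑ i, b i)
    (hb : ∀ i, b i = if 1 < w i then D else 0) (hne : a ≠ b) :
    ∏ i, w i ^ a i < ∏ i, w i ^ b i := by
  classical
  have hle : ∀ i, w i ^ a i ≤ w i ^ b i := by
    intro i
    rw [hb i]
    split_ifs with h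
    · exact pow_le_pow_right₀ h.le (ha i)
    · rw [pow_zero]
      exact pow_le_one₀ zero_le (not_lt.mp h)
  -- Since the degrees agree, `a ≠ b` forces a strict loss at some index, where `b i₀ = D` and `w i₀
  -- > 1`; there the inequality becomes strict.
  obtain ⟨i₀, hi₀⟩ : ∃ i, a i < b i := by
    by_contra! hcon
    have := (Finset.sum_eq_sum_iff_of_le fun i _ => hcon i).mp hab.symm
    exact hne (Finsupp.ext fun i => (this i (Finset.mem_univ i)).symm)
  have hi₀w : 1 < w i₀ := by
    by_contra h
    rw [hb i₀, if_neg h] at hi₀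
    omega
  rw [← Finset.mul_prod_erase _ _ (Finset.mem_univ i₀),
    ← Finset.mul_prod_erase Finset.univ (fun i => w i ^ b i) (Finset.mem_univ i₀)]
  have h1 : w i₀ ^ a i₀ < w i₀ ^ b i₀ := pow_lt_pow_right₀ hi₀w hi₀
  have h2 : ∏ i ∈ Finset.univ.erase i₀, w i ^ a i ≤ ∏ i ∈ Finset.univ.erase i₀, w i ^ b i :=
    Finset.prod_le_prod' fun i _ => hle i
  have h3 : (0 : Γ) < ∏ i ∈ Finset.univ.erase i₀, w i ^ b i :=
    zero_lt_iff.mpr (Finset.prod_ne_zero_iff.mpr fun i _ => pow_ne_zero _ (hw i))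
  calc _ ≤ w i₀ ^ a i₀ * ∏ i ∈ Finset.univ.erase i₀, w i ^ b i := mul_le_mul_right h2 _
    _ < _ := mul_lt_mul_of_pos_right h1 h3

/-- Polynomials which resemble the elementary symmetric polynomials in the `D`-th powers of the
variables generate a subring over which all polynomials are integral. -/
theorem isIntegral_X_of_dominant {k D : ℕ} (hD : D ≠ 0) (hk : Fintype.card σ ≤ k) (t : Fin k → MvPolynomial σ ℚ)
    (hdeg : ∀ j, ∀ a ∈ (t j).support, ∑ i, a i = (j + 1) * D ∧ ∀ i, a i ≤ D)
    (hcoef : ∀ j : Fin k, ∀ a : σ →₀ ℕ, ∀ T : Finset σ, T.card = j + 1 →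
      (∀ i, a i = open Classical in if i ∈ T then D else 0) → coeff a (t j) ≠ 0) (i : σ) :
    IsIntegral (Algebra.adjoin ℚ (Set.range t)) (X i : MvPolynomial σ ℚ) := by
  classical
  let A := Algebra.adjoin ℚ (Set.range t)
  let K := FractionRing (MvPolynomial σ ℚ)
  let ι : MvPolynomial σ ℚ →+* K := algebraMap _ _
  have hι : Function.Injective ι := IsFractionRing.injective _ _
  let R : Subring K := A.toSubring.map ι
  -- The valuative criterion concerns subrings of a field, so `A` is replaced by its isomorphic
  -- image `R` in the fraction field.
  suffices h : IsIntegral R (ι (X i)) by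
    let f : A →+* R := (ι.comp A.toSubring.subtype).codRestrict R
      fun x => Subring.mem_map.mpr ⟨x, x.2, rfl⟩
    have hf : Function.Bijective f := by
      constructor
      · intro x y hxy
        exact Subtype.ext (hι (congrArg Subtype.val hxy))
      · rintro ⟨y, hy⟩
        obtain ⟨x, hx, rfl⟩ := Subring.mem_map.mp hy
        exact ⟨⟨x, hx⟩, rfl⟩
    let e : A ≃+* R := RingEquiv.ofBijective f hf
    have h1 : IsIntegral A (ι (X i)) := by
      refine IsIntegral.map_of_comp_eq (e.symm : R →+* A) (RingHom.id K) ?_ h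
      ext y
      obtain ⟨x, rfl⟩ := e.surjective y
      change algebraMap A K (e.symm (e x)) = algebraMap R K (e x)
      rw [e.symm_apply_apply]
      rfl
    exact (isIntegral_algebraMap_iff hι).mp h1
  -- The integral closure of `R` in `K` is the intersection of the valuation rings containing `R`.
  have hmem := SetLike.ext_iff.mp (iInf_valuationSubring_superset (s := (R : Set K))) (ι (X i))
  rw [Subring.closure_eq] at hmem
  refine hmem.mp ?_
  rw [Subring.mem_iInf]
  rintro ⟨V, hV⟩
  change ι (X i) ∈ V
  by_contra hi
  have hVA : ∀ p ∈ A, ι p ∈ V := fun p hp => hV (Subring.mem_map.mpr ⟨p, hp, rfl⟩)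
  have hVq : ∀ c : ℚ, algebraMap ℚ K c ∈ V := fun c => by
    have h := hVA (algebraMap ℚ _ c) (A.algebraMap_mem c)
    rwa [show ι (algebraMap ℚ _ c) = algebraMap ℚ K c from
      (IsScalarTower.algebraMap_apply ℚ (MvPolynomial σ ℚ) K c).symm] at h
  let w : σ → V.ValueGroup := fun i => V.valuation (ι (X i))
  have hw : ∀ i, w i ≠ 0 := fun i => by
    rw [Ne, map_eq_zero, map_eq_zero_iff ι hι]
    exact X_ne_zero i
  -- If `X i` is not in `V`, the set `T` of variables of value greater than `1` is nonempty. The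
  -- polynomial of order `|T|` has `∏_{T} X^D` as its unique monomial of largest value, so its own
  -- value exceeds `1`, although it lies in `V`.
  let T : Finset σ := Finset.univ.filter fun i => 1 < w i
  have hiT : i ∈ T := by
    refine Finset.mem_filter.mpr ⟨Finset.mem_univ i, ?_⟩
    rw [← V.valuation_le_one_iff, not_le] at hi
    exact hi
  have hTpos : 0 < T.card := Finset.card_pos.mpr ⟨i, hiT⟩
  have hTk : T.card ≤ k := T.card_le_univ.trans hk
  let j : Fin k := ⟨T.card - 1, by omega⟩
  have hj : T.card = j + 1 := by simp only [j]; omega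
  let b : σ →₀ ℕ := Finsupp.equivFunOnFinite.symm fun i => if i ∈ T then D else 0
  have hbT : ∀ i, b i = if i ∈ T then D else 0 := fun i => rfl
  have hb : b ∈ (t j).support := mem_support_iff.mpr (hcoef j b T hj fun i => by
    rw [hbT])
  have hbw : ∀ i, b i = if 1 < w i then D else 0 := fun i => by
    rw [hbT]; simp only [T, Finset.mem_filter, Finset.mem_univ, true_and]
  have hval : ∀ a ∈ (t j).support,
      V.valuation (ι (monomial a (coeff a (t j)))) = ∏ i, w i ^ a i := by
    intro a ha
    rw [monomial_eq, Finsupp.prod_fintype _ _ (by simp), map_mul, map_mul, map_prod, map_prod]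
    have : ι (C (coeff a (t j))) = algebraMap ℚ K (coeff a (t j)) :=
      (IsScalarTower.algebraMap_apply ℚ (MvPolynomial σ ℚ) K _).symm
    rw [this, valuation_algebraMap_rat V hVq (mem_support_iff.mp ha), one_mul]
    exact Finset.prod_congr rfl fun i _ => by rw [map_pow, map_pow]
  have hsum : V.valuation (ι (t j)) = ∏ i, w i ^ b i := by
    conv_lhs => rw [as_sum (t j), map_sum]
    rw [Valuation.map_sum_eq_of_lt V.valuation hb, hval b hb]
    intro a ha
    obtain ⟨ha, hab⟩ := Finset.mem_sdiff.mp ha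
    rw [hval a ha, hval b hb]
    exact prod_pow_lt_prod_pow hw (hdeg j a ha).2 ((hdeg j a ha).1.trans (hdeg j b hb).1.symm) hbw
      (by simpa using hab)
  have hle := (V.valuation_le_one_iff _).mpr (hVA (t j) (Algebra.subset_adjoin ⟨j, rfl⟩))
  rw [hsum] at hle
  refine absurd hle (not_le.mpr ?_)
  have hlt : 1 < w i ^ b i := by
    rw [hbT, if_pos hiT]
    exact one_lt_pow₀ (Finset.mem_filter.mp hiT).2 hD
  refine hlt.trans_le (Finset.single_le_prod' (f := fun i => w i ^ b i) (fun l _ => ?_)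
    (Finset.mem_univ i))
  change 1 ≤ w l ^ b l
  rw [hbw]
  split_ifs with h
  · exact one_le_pow₀ h.le
  · rw [pow_zero]

/-- The polynomial ring is algebraic over the `k` given elements and has transcendence degree `k`,
so they form a transcendence basis. -/
theorem algebraicIndependent_of_isIntegral_X {k : ℕ} (hk : k = Fintype.card σ)
    (t : Fin k → MvPolynomial σ ℚ)
    (h : ∀ i, IsIntegral (Algebra.adjoin ℚ (Set.range t)) (X i : MvPolynomial σ ℚ)) :
    AlgebraicIndependent ℚ t := by
  subst hk
  let A := Algebra.adjoin ℚ (Set.range t)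
  have hint : Algebra.IsIntegral A (MvPolynomial σ ℚ) := by
    refine ⟨fun p => ?_⟩
    induction p using MvPolynomial.induction_on with
    | C c => exact isIntegral_algebraMap (x := algebraMap ℚ A c)
    | add p q hp hq => exact hp.add hq
    | mul_X p i hp => exact hp.mul (h i)
  have halg : Algebra.IsAlgebraic A (MvPolynomial σ ℚ) := inferInstance
  refine (Algebra.IsAlgebraic.isTranscendenceBasis_of_lift_le_trdeg_of_finite ℚ t ?_).1
  rw [MvPolynomial.trdeg_of_isDomain]
  simp

end Valuations

/-! ### Iterated differences and divided-power coefficients -/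

section Differences

open MvPolynomial

/-- A sequence with values `0` and `1` of which a high difference vanishes is constant. -/
theorem eq_succ_of_fwdDiff_iter_eq_zero {g : ℕ → ℚ} {m N : ℕ} (hmN : 2 * N ≤ m)
    (h01 : ∀ i ≤ m, g i = 0 ∨ g i = 1) (hg : ∀ i, i + N ≤ m → (fwdDiff 1)^[N] g i = 0)
    {i : ℕ} (hi : i < m) : g i = g (i + 1) := by
  have hzero : ∀ l i, i + (N + l) ≤ m → (fwdDiff 1)^[N + l] g i = 0 := by
    intro l
    induction l with
    | zero => exact hg
    | succ l ih =>
      intro i hi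
      rw [← add_assoc, Function.iterate_succ_apply', fwdDiff, ih i (by omega),
        ih (i + 1) (by omega), sub_zero]
  -- Newton interpolation: as differences of order at least `N` vanish, `g` agrees on `0, …, m` with
  -- a polynomial of degree less than `N` (zero if `N = 0`).
  let p : Polynomial ℚ := ∑ k ∈ Finset.range N,
    Polynomial.C ((fwdDiff 1)^[k] g 0 / k.factorial) * descPochhammer ℚ k
  have hp : ∀ i ≤ m, p.eval (i : ℚ) = g i := by
    intro i hi
    have h1 := shift_eq_sum_fwdDiff_iter 1 g i 0
    rw [smul_eq_mul, mul_one, zero_add] at h1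
    have h2 : ∀ k, (i.choose k • (fwdDiff 1)^[k] g 0 : ℚ) =
        (Polynomial.C ((fwdDiff 1)^[k] g 0 / k.factorial) * descPochhammer ℚ k).eval (i : ℚ) := by
      intro k
      rw [Polynomial.eval_mul, Polynomial.eval_C, descPochhammer_eval_eq_descFactorial,
        Nat.descFactorial_eq_factorial_mul_choose, nsmul_eq_mul]
      push_cast
      have : (k.factorial : ℚ) ≠ 0 := by exact_mod_cast k.factorial_ne_zero
      field_simp
    rw [h1, Polynomial.eval_finsetSum]
    simp only [← h2]
    -- Terms with `k > i` vanish through the binomial coefficient and terms with `k ≥ N` through the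
    -- difference, so both sums reduce to `k < min N (i + 1)`.
    rw [← Finset.sum_subset (s₁ := Finset.range (min N (i + 1))) (s₂ := Finset.range N),
      ← Finset.sum_subset (s₁ := Finset.range (min N (i + 1))) (s₂ := Finset.range (i + 1))]
    · intro k hk; simp at hk ⊢; omega
    · intro k hk hk'
      simp only [Finset.mem_range] at hk hk'
      have := hzero (k - N) 0 (by omega)
      rw [show N + (k - N) = k by omega] at this
      rw [this, smul_zero]
    · intro k hk; simp at hk ⊢; omega
    · intro k hk hk'
      simp only [Finset.mem_range] at hk hk'
      rw [Nat.choose_eq_zero_of_lt (by omega), zero_smul]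
  have hdeg : p.natDegree ≤ N - 1 := by
    refine Polynomial.natDegree_sum_le_of_forall_le _ _ fun k hk => ?_
    refine (Polynomial.natDegree_C_mul_le _ _).trans ?_
    rw [descPochhammer_natDegree]
    have := Finset.mem_range.mp hk
    omega
  -- The product vanishes at the `m + 1` points `0, …, m`, more than its degree allows since `2 * N
  -- ≤ m`. So `p` is one of the constants `0` and `1`.
  have hprod : p * (p - 1) = 0 := by
    refine Polynomial.eq_zero_of_natDegree_lt_card_of_eval_eq_zero'
      (p * (p - 1)) ((Finset.range (m + 1)).image (fun i : ℕ => (i : ℚ))) ?_ ?_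
    · intro x hx
      obtain ⟨i, hi, rfl⟩ := Finset.mem_image.mp hx
      have hi' : i ≤ m := Nat.lt_succ_iff.mp (Finset.mem_range.mp hi)
      rw [Polynomial.eval_mul, Polynomial.eval_sub, Polynomial.eval_one, hp i hi']
      rcases h01 i hi' with h | h <;> simp [h]
    · rw [Finset.card_image_of_injective _ Nat.cast_injective, Finset.card_range]
      have h1 : (p - 1).natDegree ≤ N - 1 :=
        (Polynomial.natDegree_sub_le _ _).trans (by simpa using hdeg)
      have h2 := Polynomial.natDegree_mul_le (p := p) (q := p - 1)
      omega
  have hcases : p = 0 ∨ p = 1 := by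
    rcases mul_eq_zero.mp hprod with h | h
    · exact Or.inl h
    · exact Or.inr (sub_eq_zero.mp h)
  rw [← hp i hi.le, ← hp (i + 1) hi]
  rcases hcases with h | h <;> simp [h]

variable {σ : Type*} [Fintype σ]

/-- The coefficients of a polynomial with respect to the divided powers of the variables. -/
def divCoeff (p : MvPolynomial σ ℚ) (a : σ →₀ ℕ) : ℚ := (∏ i, ((a i).factorial : ℚ)) * coeff a p

theorem prod_factorial_add_single (a : σ →₀ ℕ) (i : σ) :
    ∏ l, (((a + Finsupp.single i 1 : σ →₀ ℕ) l).factorial : ℚ) =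
      (∏ l, ((a l).factorial : ℚ)) * (a i + 1) := by
  classical
  rw [← Finset.mul_prod_erase _ _ (Finset.mem_univ i),
    ← Finset.mul_prod_erase Finset.univ (fun l => ((a l).factorial : ℚ)) (Finset.mem_univ i)]
  have : ∀ l ∈ Finset.univ.erase i, (((a + Finsupp.single i 1 : σ →₀ ℕ) l).factorial : ℚ) =
      ((a l).factorial : ℚ) := by
    intro l hl
    rw [Finsupp.add_apply, Finsupp.single_eq_of_ne (Finset.ne_of_mem_erase hl), add_zero]
  rw [Finset.prod_congr rfl this, Finsupp.add_apply, Finsupp.single_eq_same, Nat.factorial_succ]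
  push_cast
  ring

theorem prod_factorial_ne_zero (a : σ →₀ ℕ) : (∏ i, ((a i).factorial : ℚ)) ≠ 0 :=
  Finset.prod_ne_zero_iff.mpr fun i _ => by exact_mod_cast (a i).factorial_ne_zero

/-- The reason for divided powers: differentiation becomes a pure shift of coefficients, so `∂/∂b -
∂/∂c` becomes a difference operator without weights. -/
theorem divCoeff_pderiv (p : MvPolynomial σ ℚ) (i : σ) (a : σ →₀ ℕ) :
    divCoeff (pderiv i p) a = divCoeff p (a + Finsupp.single i 1) := by
  rw [divCoeff, divCoeff, coeff_pderiv, prod_factorial_add_single]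
  ring

/-- The derivation `∂ / ∂ b - ∂ / ∂ c`. -/
def diffDeriv (b c : σ) : Derivation ℚ (MvPolynomial σ ℚ) (MvPolynomial σ ℚ) :=
  pderiv b - pderiv c

theorem divCoeff_diffDeriv (p : MvPolynomial σ ℚ) (b c : σ) (a : σ →₀ ℕ) :
    divCoeff (diffDeriv b c p) a =
      divCoeff p (a + Finsupp.single b 1) - divCoeff p (a + Finsupp.single c 1) := by
  rw [← divCoeff_pderiv, ← divCoeff_pderiv, diffDeriv, Derivation.sub_apply]
  simp [divCoeff, mul_sub]

theorem exists_divCoeff_ne_zero {p : MvPolynomial σ ℚ} (hp : p ≠ 0) : ∃ a, divCoeff p a ≠ 0 := by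
  obtain ⟨a, ha⟩ := MvPolynomial.ne_zero_iff.mp hp
  exact ⟨a, mul_ne_zero (prod_factorial_ne_zero a) ha⟩

/-- Along the line through `a` in the direction of `b - c`, the iterates of `∂ / ∂ b - ∂ / ∂ c` act
as iterated differences. -/
theorem divCoeff_diffDeriv_iterate (p : MvPolynomial σ ℚ) (b c : σ) (a : σ →₀ ℕ) (m N : ℕ) :
    ∀ i l : ℕ, i + l + N = m →
      divCoeff ((diffDeriv b c)^[N] p) (a + Finsupp.single b i + Finsupp.single c l) =
        (fwdDiff 1)^[N] (fun i => divCoeff p (a + Finsupp.single b i + Finsupp.single c (m - i)))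
          i := by
  induction N with
  | zero =>
    rintro i l rfl
    simp
  | succ N ih =>
    intro i l h
    rw [Function.iterate_succ_apply', Function.iterate_succ_apply', divCoeff_diffDeriv, fwdDiff,
      ← ih (i + 1) l (by omega), ← ih i (l + 1) (by omega), Finsupp.single_add, Finsupp.single_add]
    congr 2
    · abel
    · abel

/-- Each application lowers the degree bound by one. The index depends on `p`; finite generation
will later make it uniform. -/
theorem exists_diffDeriv_iterate_eq_zero (p : MvPolynomial σ ℚ) (b c : σ) :
    ∃ N, (diffDeriv b c)^[N] p = 0 := by
  have key : ∀ (N : ℕ) (p : MvPolynomial σ ℚ), (∀ a : σ →₀ ℕ, N ≤ a.degree → divCoeff p a = 0) →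
      (diffDeriv b c)^[N] p = 0 := by
    intro N
    induction N with
    | zero =>
      intro p h
      by_contra hp
      obtain ⟨a, ha⟩ := exists_divCoeff_ne_zero hp
      exact ha (h a (Nat.zero_le _))
    | succ N ih =>
      intro p h
      rw [Function.iterate_succ_apply]
      refine ih _ fun a ha => ?_
      rw [divCoeff_diffDeriv, h _ (by simp [ha]), h _ (by simp [ha]), sub_zero]
  refine ⟨p.totalDegree + 1, key _ p fun a ha => ?_⟩
  rw [divCoeff, coeff_eq_zero_of_totalDegree_lt, mul_zero]
  rw [Finsupp.degree_apply] at ha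
  exact ha

theorem diffDeriv_iterate_mul {σ : Type*} {b c : σ} {p : MvPolynomial σ ℚ} (hp : diffDeriv b c p = 0)
    (q : MvPolynomial σ ℚ) (N : ℕ) :
    (diffDeriv b c)^[N] (p * q) = p * (diffDeriv b c)^[N] q := by
  induction N with
  | zero => rfl
  | succ N ih => simp [Function.iterate_succ_apply', ih, hp]

end Differences

open MvPolynomial

/-! ### Polynomials in the block sums -/

section BlockHom

variable {E : Type w}

open Classical in
/-- The sum of the singletons contained in `B`. -/
def blockSum (B : Set E) : SetAlgebra E := fun A => if ∃ x ∈ B, A = {x} then 1 else 0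

open Classical in
theorem coeff_blockSum (B : Set E) (A : Finset E) :
    (blockSum B).coeff A = if ∃ x ∈ B, A = {x} then 1 else 0 := rfl

open Classical in
theorem coeff_blockSum_mul (B : Set E) (f : SetAlgebra E) (A : Finset E) :
    (blockSum B * f).coeff A = ∑ x ∈ A with x ∈ B, f.coeff (A.erase x) := by
  rw [SetAlgebra.coeff_mul]
  symm
  refine Finset.sum_of_injOn (fun x => {x}) (Finset.singleton_injective.injOn) ?_ ?_ ?_
  · intro x hx
    simp only [Finset.coe_filter, Set.mem_ofPred_eq] at hx
    simpa using hx.1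
  · intro Z hZ hZ'
    rw [coeff_blockSum, if_neg, zero_mul]
    rintro ⟨x, hx, rfl⟩
    refine hZ' ⟨x, ?_, rfl⟩
    simp only [Finset.coe_filter, Set.mem_ofPred_eq]
    exact ⟨by simpa using hZ, hx⟩
  · intro x hx
    rw [coeff_blockSum, if_pos ⟨x, (Finset.mem_filter.mp hx).2, rfl⟩, one_mul,
      Finset.erase_eq]

variable (S : Set (Set E)) [Fintype S]

/-- The numbers of elements of a finite set in the blocks. -/
def count (A : Finset E) : S →₀ ℕ :=
  Finsupp.equivFunOnFinite.symm fun B => ((A : Set E) ∩ B).ncard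

theorem count_apply (A : Finset E) (B : S) : count S A B = ((A : Set E) ∩ B).ncard := rfl

/-- The homomorphism which sends the variable of each block to the sum of its singletons. -/
def blockHom : MvPolynomial S ℚ →ₐ[ℚ] SetAlgebra E := aeval fun B => blockSum B.1

variable {S}

open Classical in
theorem count_insert (hS : S.PairwiseDisjoint id) {A : Finset E} {x : E} (hx : x ∉ A) {B : S}
    (hB : x ∈ B.1) : count S (insert x A) = count S A + Finsupp.single B 1 := by
  ext C
  rw [Finsupp.add_apply, count_apply, count_apply, Finset.coe_insert]
  by_cases hC : B = C
  · subst hC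
    rw [ncard_inter_insert_of_mem hx hB, Finsupp.single_eq_same]
  · rw [Finsupp.single_eq_of_ne (Ne.symm hC), ncard_inter_insert_of_notMem, add_zero]
    intro hxC
    exact Set.disjoint_left.mp (hS B.2 C.2 fun h => hC (Subtype.ext h)) hB hxC

theorem count_empty : count S (∅ : Finset E) = 0 := by
  ext B; simp [count_apply]

theorem eq_empty_of_count_eq_zero {A : Finset E} (hA : (A : Set E) ⊆ ⋃₀ S)
    (h : count S A = 0) : A = ∅ := by
  by_contra hne
  obtain ⟨x, hx⟩ := Finset.nonempty_iff_ne_empty.mpr hne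
  obtain ⟨B, hB, hxB⟩ := hA hx
  have h1 : count S A ⟨B, hB⟩ = 0 := by rw [h]; rfl
  rw [count_apply, Set.ncard_eq_zero (A.finite_toSet.inter_of_left _)] at h1
  exact Set.notMem_empty x (h1 ▸ ⟨hx, hxB⟩)

theorem count_apply_le (A : Finset E) (B : S) : count S A B ≤ A.card := by
  rw [count_apply, ← Set.ncard_coe_finset]
  exact Set.ncard_le_ncard Set.inter_subset_left A.finite_toSet

theorem sum_count (hS : S.PairwiseDisjoint id) {A : Finset E} (hA : (A : Set E) ⊆ ⋃₀ S) :
    ∑ B, count S A B = A.card := by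
  classical
  induction A using Finset.induction_on with
  | empty => simp [count_empty]
  | insert x A hx ih =>
    rw [Finset.coe_insert, Set.insert_subset_iff] at hA
    obtain ⟨⟨B, hB, hxB⟩, hA⟩ := hA
    rw [count_insert hS hx (B := ⟨B, hB⟩) hxB, Finset.card_insert_of_notMem hx, ← ih hA]
    simp only [Finsupp.add_apply, Finset.sum_add_distrib]
    congr 1
    simp [Finsupp.single_apply]

theorem divCoeff_mul_X {σ : Type*} [Fintype σ] (p : MvPolynomial σ ℚ) (i : σ) (a : σ →₀ ℕ) :
    divCoeff (p * X i) a = a i * divCoeff p (a - Finsupp.single i 1) := by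
  classical
  rw [divCoeff, coeff_mul_X']
  by_cases h : a i = 0
  · rw [if_neg (by simpa using h), h]; simp
  · rw [if_pos (by simpa using h)]
    obtain ⟨b, rfl⟩ : ∃ b, a = b + Finsupp.single i 1 :=
      ⟨a - Finsupp.single i 1, (tsub_add_cancel_of_le
        (Finsupp.single_le_iff.mpr (Nat.one_le_iff_ne_zero.mpr h))).symm⟩
    rw [prod_factorial_add_single, add_tsub_cancel_right, divCoeff, Finsupp.add_apply,
      Finsupp.single_eq_same]
    push_cast
    ring

open Classical in
/-- The coefficients of the image of a polynomial are its coefficients with respect to the divided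
powers. -/
theorem coeff_blockHom (hS : S.PairwiseDisjoint id) (p : MvPolynomial S ℚ) (A : Finset E) :
    (blockHom S p).coeff A = if (A : Set E) ⊆ ⋃₀ S then divCoeff p (count S A) else 0 := by
  induction p using MvPolynomial.induction_on generalizing A with
  | C c =>
    rw [← algebraMap_eq, AlgHom.commutes, Algebra.algebraMap_eq_smul_one, SetAlgebra.coeff_smul,
      SetAlgebra.coeff_one]
    by_cases hA : A = ∅
    · subst hA
      simp [count_empty, divCoeff]
    · rw [if_neg hA, mul_zero]
      split_ifs with h
      · rw [divCoeff, algebraMap_eq, coeff_C, if_neg, mul_zero]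
        exact fun h0 => hA (eq_empty_of_count_eq_zero h h0.symm)
      · rfl
  | add p q hp hq =>
    rw [map_add, SetAlgebra.coeff_add, hp, hq]
    split_ifs
    · simp [divCoeff, mul_add]
    · simp
  | mul_X p B hp =>
    rw [map_mul, mul_comm]
    have : blockHom S (X B) = blockSum B.1 := aeval_X _ _
    rw [this, coeff_blockSum_mul]
    split_ifs with hA
    · rw [divCoeff_mul_X]
      have : ∀ x ∈ A.filter (· ∈ B.1), (blockHom S p).coeff (A.erase x) =
          divCoeff p (count S A - Finsupp.single B 1) := by
        intro x hx
        obtain ⟨hxA, hxB⟩ := Finset.mem_filter.mp hx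
        rw [hp, if_pos ((Finset.coe_subset.mpr (Finset.erase_subset x A)).trans hA)]
        conv_rhs => rw [← Finset.insert_erase hxA, count_insert hS (by simp) hxB]
        rw [add_tsub_cancel_right]
      rw [Finset.sum_congr rfl this, Finset.sum_const, nsmul_eq_mul, count_apply,
        ← Set.ncard_coe_finset]
      congr 3
      ext; simp
    · refine Finset.sum_eq_zero fun x hx => ?_
      obtain ⟨hxA, hxB⟩ := Finset.mem_filter.mp hx
      rw [hp, if_neg]
      intro h
      refine hA fun y hy => ?_
      by_cases hyx : y = x
      · subst hyx
        exact ⟨B.1, B.2, hxB⟩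
      · exact h (by simpa using ⟨hy, hyx⟩)

/-- The coefficients as a function of the count vector, divided by factorials, define the required
polynomial. Bounded degree is what makes it a finite sum. -/
theorem mem_range_blockHom (hS : S.PairwiseDisjoint id) {f : SetAlgebra E} {n : ℕ}
    (hn : ∀ A, f.coeff A ≠ 0 → A.card ≤ n) (hsupp : ∀ A, f.coeff A ≠ 0 → (A : Set E) ⊆ ⋃₀ S)
    (hcount : ∀ A A' : Finset E, (A : Set E) ⊆ ⋃₀ S → (A' : Set E) ⊆ ⋃₀ S →
      count S A = count S A' → f.coeff A = f.coeff A') :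
    ∃ p, blockHom S p = f := by
  classical
  let c : (S →₀ ℕ) → ℚ := fun a =>
    if h : ∃ A : Finset E, (A : Set E) ⊆ ⋃₀ S ∧ count S A = a then f.coeff h.choose else 0
  have hc : ∀ A : Finset E, (A : Set E) ⊆ ⋃₀ S → c (count S A) = f.coeff A := by
    intro A hA
    have h : ∃ A' : Finset E, (A' : Set E) ⊆ ⋃₀ S ∧ count S A' = count S A := ⟨A, hA, rfl⟩
    simp only [c, dif_pos h]
    exact hcount _ _ h.choose_spec.1 hA h.choose_spec.2
  -- A set with nonzero coefficient has at most `n` elements, so its count vector lies in the box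
  -- below `b`. Vectors that no set realizes receive the value `0` in `c`.
  let b : S →₀ ℕ := Finsupp.equivFunOnFinite.symm fun _ => n
  let p : MvPolynomial S ℚ :=
    ∑ a ∈ Finset.Iic b, monomial a (c a / ∏ i, ((a i).factorial : ℚ))
  refine ⟨p, ?_⟩
  ext A
  rw [coeff_blockHom hS]
  split_ifs with hA
  · have h1 : coeff (count S A) p = if count S A ∈ Finset.Iic b then
        c (count S A) / ∏ i, ((count S A i).factorial : ℚ) else 0 := by
      simp only [p, coeff_sum, coeff_monomial]
      rw [Finset.sum_ite_eq']
    rw [divCoeff, h1]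
    split_ifs with h2
    · rw [hc A hA, mul_div_cancel₀ _ (prod_factorial_ne_zero _)]
    · rw [mul_zero]
      by_contra h3
      refine h2 (Finset.mem_Iic.mpr fun B => ?_)
      exact (count_apply_le A B).trans (hn A (Ne.symm h3))
  · by_contra h
    exact hA (hsupp A (Ne.symm h))

theorem pairwiseDisjoint_of_subset_classes {P : Setoid E} {S : Set (Set E)} (hS : S ⊆ P.classes) :
    S.PairwiseDisjoint id := fun _ hB _ hC hBC =>
  Set.disjoint_left.mpr fun _ hxB hxC => hBC (eq_of_mem_of_mem_classes (hS hB) (hS hC) hxB hxC)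

/-- Every vector of numbers is realized by a finite set in infinite blocks, avoiding a given finite
set. -/
theorem exists_count_eq {P : Setoid E} (hS : S ⊆ infiniteBlocks P) (F : Finset E) (a : S →₀ ℕ) :
    ∃ A : Finset E, (A : Set E) ⊆ ⋃₀ S ∧ Disjoint A F ∧ count S A = a := by
  classical
  obtain ⟨V, hVF, hVS, hV⟩ := exists_finset_ncard_inter (P := P) (S := S)
    (fun B hB => (hS hB).1) S.toFinite ((F : Set E)ᶜ)
    (fun B => if h : B ∈ S then a ⟨B, h⟩ else 0) (fun B hB => by
      have : ((F : Set E)ᶜ ∩ B).Infinite := by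
        rw [Set.inter_comm, ← Set.sdiff_eq]
        exact (hS hB).2.sdiff F.finite_toSet
      rw [this.encard_eq]
      exact le_top)
  refine ⟨V, hVS, ?_, ?_⟩
  · rw [Finset.disjoint_left]
    exact fun x hx => by simpa using hVF hx
  · ext B
    rw [count_apply, hV B B.2, dif_pos B.2]

/-- In infinite blocks every exponent vector is the count vector of some set, so every coefficient
of the polynomial is visible in its image. -/
theorem blockHom_injective {P : Setoid E} (hS : S ⊆ infiniteBlocks P) :
    Function.Injective (blockHom S) := by
  rw [injective_iff_map_eq_zero]
  intro p hp
  by_contra hne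
  obtain ⟨a, ha⟩ := exists_divCoeff_ne_zero hne
  obtain ⟨A, hA, -, rfl⟩ := exists_count_eq hS ∅ a
  refine ha ?_
  have := coeff_blockHom (pairwiseDisjoint_of_subset_classes fun B hB => (hS hB).1) p A
  rw [if_pos hA, hp] at this
  exact this.symm

end BlockHom

/-! ### Components along a fixed outer set, restriction, and nilpotents -/

section Shift

variable {E : Type w}

open Classical in
/-- The linear combination of subsets of `X` in which the coefficient of `A` is the one of
`A ∪ U` in the given one. -/
def shift (X : Set E) (U : Finset E) : SetAlgebra E →ₗ[ℚ] SetAlgebra E where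
  toFun f := fun A => if (A : Set E) ⊆ X then f.coeff (A ∪ U) else 0
  map_add' f g := by
    ext A
    change (if _ then _ else _) = (if _ then _ else _) + (if _ then _ else _ : ℚ)
    split_ifs <;> simp
  map_smul' c f := by
    ext A
    change (if _ then _ else _) = c * (if _ then _ else _ : ℚ)
    split_ifs <;> simp

open Classical in
theorem coeff_shift (X : Set E) (U : Finset E) (f : SetAlgebra E) (A : Finset E) :
    (shift X U f).coeff A = if (A : Set E) ⊆ X then f.coeff (A ∪ U) else 0 := rfl

open Classical in
theorem coeff_sum {ι : Type*} (s : Finset ι) (f : ι → SetAlgebra E) (A : Finset E) :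
    (∑ i ∈ s, f i).coeff A = ∑ i ∈ s, (f i).coeff A := by
  induction s using Finset.induction_on with
  | empty => rfl
  | insert i s hi ih => rw [Finset.sum_insert hi, Finset.sum_insert hi, SetAlgebra.coeff_add, ih]

open Classical in
-- A subset of `A ∪ U` with `A ⊆ X` splits uniquely into its parts in `A` and in `U`. This
-- Leibniz-like rule drives the necessity proof; for `U = ∅` it says that restriction is
-- multiplicative.
theorem shift_mul {X : Set E} {U : Finset E} (hU : ∀ x ∈ U, x ∉ X) (f g : SetAlgebra E) :
    shift X U (f * g) = ∑ V ∈ U.powerset, shift X V f * shift X (U \ V) g := by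
  ext A
  rw [coeff_sum, coeff_shift]
  split_ifs with hA
  · simp only [SetAlgebra.coeff_mul]
    have hAU : ∀ x ∈ A, x ∉ U := fun x hx hxU => hU x hxU (hA hx)
    rw [Finset.sum_sigma']
    refine Finset.sum_bij' (fun Z _ => ⟨Z ∩ U, Z ∩ A⟩) (fun p _ => p.2 ∪ p.1) ?_ ?_ ?_ ?_ ?_
    · intro Z _
      simp
    · rintro ⟨V, Z⟩ h
      simp only [Finset.mem_sigma, Finset.mem_powerset] at h
      exact Finset.mem_powerset.mpr (Finset.union_subset_union h.2 h.1)
    · intro Z hZ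
      have hZ := Finset.mem_powerset.mp hZ
      simp only
      rw [← Finset.inter_union_distrib_left]
      exact Finset.inter_eq_left.mpr hZ
    · rintro ⟨V, Z⟩ h
      simp only [Finset.mem_sigma, Finset.mem_powerset] at h
      have h1 : (Z ∪ V) ∩ U = V := by
        ext x
        have := @h.1 x; have := @h.2 x; have := hAU x
        simp only [Finset.mem_inter, Finset.mem_union]; tauto
      have h2 : (Z ∪ V) ∩ A = Z := by
        ext x
        have := @h.1 x; have := @h.2 x; have := hAU x
        simp only [Finset.mem_inter, Finset.mem_union]; tauto
      simp only [h1, h2]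
    · intro Z hZ
      have hZ := Finset.mem_powerset.mp hZ
      rw [coeff_shift, coeff_shift, if_pos, if_pos]
      · congr 2
        · rw [← Finset.inter_union_distrib_left]
          exact (Finset.inter_eq_left.mpr hZ).symm
        · ext x
          have := hAU x
          simp only [Finset.mem_sdiff, Finset.mem_inter, Finset.mem_union]; tauto
      · exact (Finset.coe_subset.mpr Finset.sdiff_subset).trans hA
      · exact (Finset.coe_subset.mpr Finset.inter_subset_right).trans hA
  · symm
    refine Finset.sum_eq_zero fun V _ => ?_
    rw [SetAlgebra.coeff_mul]
    refine Finset.sum_eq_zero fun Z hZ => ?_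
    rw [coeff_shift, coeff_shift]
    by_cases h1 : (Z : Set E) ⊆ X
    · rw [if_neg (c := ((A \ Z : Finset E) : Set E) ⊆ X), mul_zero]
      intro h2
      refine hA fun x hx => ?_
      by_cases hxZ : x ∈ Z
      · exact h1 hxZ
      · exact h2 (by simpa using ⟨hx, hxZ⟩)
    · rw [if_neg h1, zero_mul]

/-- Discarding the sets which are not contained in `X`. -/
def restrictHom (X : Set E) : SetAlgebra E →ₐ[ℚ] SetAlgebra E :=
  AlgHom.ofLinearMap (shift X ∅)
    (by
      classical
      ext A
      rw [coeff_shift, Finset.union_empty, SetAlgebra.coeff_one]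
      by_cases hA : A = ∅
      · simp [hA]
      · simp [hA])
    (fun f g => by
      classical
      rw [shift_mul (by simp)]
      simp)

open Classical in
theorem coeff_restrictHom (X : Set E) (f : SetAlgebra E) (A : Finset E) :
    (restrictHom X f).coeff A = if (A : Set E) ⊆ X then f.coeff A else 0 := by
  change (shift X ∅ f).coeff A = _
  rw [coeff_shift, Finset.union_empty]

/-- A linear combination of sets which meet a given finite set is nilpotent. -/
theorem isNilpotent_of_coeff_eq_zero {X : Set E} (hX : Xᶜ.Finite) {f : SetAlgebra E}
    (hf : ∀ A : Finset E, (A : Set E) ⊆ X → f.coeff A = 0) : IsNilpotent f := by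
  classical
  -- Each factor uses up at least one point outside `X`, and different factors use disjoint sets.
  have key : ∀ (m : ℕ) (A : Finset E), (f ^ m).coeff A ≠ 0 → m ≤ (A.filter (· ∉ X)).card := by
    intro m
    induction m with
    | zero => intro A _; exact Nat.zero_le _
    | succ m ih =>
      intro A hA
      rw [pow_succ, SetAlgebra.coeff_mul] at hA
      obtain ⟨Z, hZ, hne⟩ := Finset.exists_ne_zero_of_sum_ne_zero hA
      have h1 := ih Z (left_ne_zero_of_mul hne)
      have h2 : 0 < ((A \ Z).filter (· ∉ X)).card := by
        rw [Finset.card_pos]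
        by_contra hcon
        refine right_ne_zero_of_mul hne (hf _ fun x hx => ?_)
        by_contra hxX
        exact hcon ⟨x, Finset.mem_filter.mpr ⟨hx, hxX⟩⟩
      have h3 : A.filter (· ∉ X) = Z.filter (· ∉ X) ∪ (A \ Z).filter (· ∉ X) := by
        rw [← Finset.filter_union, Finset.union_sdiff_of_subset (Finset.mem_powerset.mp hZ)]
      rw [h3, Finset.card_union_of_disjoint
        (Finset.disjoint_filter_filter Finset.disjoint_sdiff)]
      omega
  refine ⟨hX.toFinset.card + 1, ?_⟩
  ext A
  by_contra hne
  have h1 := key _ A hne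
  have h2 : A.filter (· ∉ X) ⊆ hX.toFinset := fun x hx => by
    simpa using (Finset.mem_filter.mp hx).2
  have := Finset.card_le_card h2
  omega

end Shift

/-! ### Elements of the age algebra as polynomials -/

section Age

variable {L : FirstOrder.Language.{u, v}} [L.IsRelational] {E : Type w} [L.Structure E]

/-- The coefficients of an element of the age algebra at the sets which extend a fixed set by
elements of some blocks are given by a polynomial. -/
theorem exists_blockHom_eq_shift {P : Setoid E} (hP : IsMonomorphicDecomposition L P)
    {S : Set (Set E)} [Fintype S] (hS : S ⊆ P.classes) {U : Finset E} (hU : ∀ x ∈ U, x ∉ ⋃₀ S)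
    (f : ageAlgebra L E) : ∃ p, blockHom S p = shift (⋃₀ S) U f.1 := by
  classical
  obtain ⟨n, hn⟩ := f.2.1
  refine mem_range_blockHom (pairwiseDisjoint_of_subset_classes hS) (n := n) ?_ ?_ ?_
  · intro A hA
    rw [coeff_shift] at hA
    split_ifs at hA
    · exact (Finset.card_le_card Finset.subset_union_left).trans (hn _ hA)
    · exact absurd rfl hA
  · intro A hA
    rw [coeff_shift] at hA
    by_contra h
    exact hA (if_neg h)
  · intro A A' hA hA' hcount
    rw [coeff_shift, coeff_shift, if_pos hA, if_pos hA']
    refine f.2.2 _ _ (hP _ _ fun B hB => ?_)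
    by_cases hBS : B ∈ S
    · have h1 : ∀ A : Finset E, ((A ∪ U : Finset E) : Set E) ∩ B = (A : Set E) ∩ B := by
        intro A
        ext x
        simp only [Finset.coe_union, Set.mem_inter_iff, Set.mem_union, Finset.mem_coe]
        constructor
        · rintro ⟨hx | hx, hxB⟩
          · exact ⟨hx, hxB⟩
          · exact absurd ⟨B, hBS, hxB⟩ (hU x hx)
        · rintro ⟨hx, hxB⟩
          exact ⟨Or.inl hx, hxB⟩
      rw [h1, h1]
      exact DFunLike.congr_fun hcount ⟨B, hBS⟩
    · have h1 : ∀ A : Finset E, (A : Set E) ⊆ ⋃₀ S →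
          ((A ∪ U : Finset E) : Set E) ∩ B = (U : Set E) ∩ B := by
        intro A hA
        ext x
        simp only [Finset.coe_union, Set.mem_inter_iff, Set.mem_union, Finset.mem_coe]
        constructor
        · rintro ⟨hx | hx, hxB⟩
          · obtain ⟨C, hC, hxC⟩ := hA hx
            exact absurd (eq_of_mem_of_mem_classes hB (hS hC) hxB hxC ▸ hC) hBS
          · exact ⟨hx, hxB⟩
        · rintro ⟨hx, hxB⟩
          exact ⟨Or.inr hx, hxB⟩
      rw [h1 A hA, h1 A' hA']

end Age

/-! ### Recursive minimality implies module finiteness and independence -/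

section Sufficiency

variable {L : FirstOrder.Language.{u, v}} [L.IsRelational] {E : Type w} [L.Structure E]

/-- Restricting the elements of the age algebra to infinite blocks yields polynomials. -/
theorem exists_algHom_mvPolynomial {P : Setoid E} (hP : IsMonomorphicDecomposition L P)
    {S : Set (Set E)} [Fintype S] (hS : S ⊆ infiniteBlocks P) :
    ∃ T : ageAlgebra L E →ₐ[ℚ] MvPolynomial S ℚ,
      ∀ f, blockHom S (T f) = restrictHom (⋃₀ S) f.1 := by
  let e := AlgEquiv.ofInjective (blockHom S) (blockHom_injective hS)
  have hmem : ∀ f : ageAlgebra L E,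
      (restrictHom (⋃₀ S)).comp (ageAlgebra L E).val f ∈ (blockHom S).range := fun f =>
    exists_blockHom_eq_shift hP (hS.trans (infiniteBlocks_subset_classes P)) (U := ∅) (by simp) f
  refine ⟨e.symm.toAlgHom.comp (AlgHom.codRestrict _ _ hmem), fun f => ?_⟩
  exact congrArg Subtype.val (e.apply_symm_apply ⟨_, hmem f⟩)

open Classical in
theorem coeff_elementary (P : Setoid E) (D j : ℕ) (A : Finset E) :
    (elementary L P D j).1.coeff A =
      if ∃ A' : Finset E, IsoOn L (A : Set E) A' ∧ IsUniform P D j A' then 1 else 0 := rfl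

theorem IsUniform.card_eq {P : Setoid E} [Fintype (infiniteBlocks P)] {D j : ℕ} {A : Finset E}
    (h : IsUniform P D j A) : A.card = j * D := by
  classical
  obtain ⟨S, hS, rfl, hA, hD⟩ := h
  have hdisj : (infiniteBlocks P).PairwiseDisjoint id :=
    pairwiseDisjoint_of_subset_classes (infiniteBlocks_subset_classes P)
  rw [← sum_count hdisj (hA.trans (Set.sUnion_subset_sUnion hS))]
  have h1 : ∀ B : infiniteBlocks P, count _ A B = if B.1 ∈ S then D else 0 := by
    intro B
    rw [count_apply]
    split_ifs with hB
    · exact hD B hB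
    · rw [Set.ncard_eq_zero (A.finite_toSet.inter_of_left _), Set.eq_empty_iff_forall_notMem]
      rintro x ⟨hxA, hxB⟩
      obtain ⟨C, hC, hxC⟩ := hA hxA
      exact hB (eq_of_mem_of_mem_classes B.2.1 (hS hC).1 hxB hxC ▸ hC)
  simp only [h1]
  rw [← Finset.sum_filter, Finset.sum_const, smul_eq_mul]
  congr 1
  refine Finset.card_bij (fun B _ => B.1) (fun B hB => (Finset.mem_filter.mp hB).2)
    (fun B _ C _ h => Subtype.ext h) fun B hB => ⟨⟨B, hS hB⟩, by simpa using hB, rfl⟩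

/-- A set with `D` elements in each block of `T`, and none in the other blocks, is uniform. -/
theorem isUniform_of_count {P : Setoid E} [Fintype (infiniteBlocks P)] {D : ℕ} {A : Finset E}
    (hA : (A : Set E) ⊆ ⋃₀ infiniteBlocks P) (T : Finset (infiniteBlocks P))
    (hT : ∀ B, count (infiniteBlocks P) A B = open Classical in if B ∈ T then D else 0) :
    IsUniform P D T.card A := by
  classical
  refine ⟨T.map (Function.Embedding.subtype _), ?_, Finset.card_map _, ?_, ?_⟩
  · intro B hB
    obtain ⟨C, -, rfl⟩ := Finset.mem_map.mp hB
    exact C.2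
  · intro x hx
    obtain ⟨B, hB, hxB⟩ := hA hx
    refine ⟨B, Finset.mem_map.mpr ⟨⟨B, hB⟩, ?_, rfl⟩, hxB⟩
    by_contra hBT
    have h := hT ⟨B, hB⟩
    rw [if_neg hBT, count_apply, Set.ncard_eq_zero (A.finite_toSet.inter_of_left _)] at h
    exact Set.notMem_empty x (h ▸ ⟨hx, hxB⟩)
  · intro B hB
    obtain ⟨C, hC, rfl⟩ := Finset.mem_map.mp hB
    have h := hT C
    rw [if_pos hC] at h
    exact h

theorem finite_infiniteBlocks (P : Setoid E) [Finite (Quotient P)] : (infiniteBlocks P).Finite :=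
  (finite_classes P).subset (infiniteBlocks_subset_classes P)

theorem finite_compl_sUnion_infiniteBlocks (P : Setoid E) [Finite (Quotient P)] :
    (⋃₀ infiniteBlocks P)ᶜ.Finite := by
  have h : (⋃₀ {B ∈ P.classes | B.Finite}).Finite :=
    Set.Finite.sUnion ((finite_classes P).subset fun _ h => h.1) fun _ h => h.2
  refine h.subset fun x hx => ?_
  refine ⟨{y | P y x}, ⟨⟨x, rfl⟩, ?_⟩, P.refl x⟩
  by_contra hinf
  exact hx ⟨{y | P y x}, ⟨⟨x, rfl⟩, hinf⟩, P.refl x⟩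

/-- If no set isomorphic to a uniform set has more than `D` elements in an infinite block, then the
variables are integral over the polynomials which correspond to the elements
`elementary L P D (j + 1)`. -/
theorem isIntegral_X_adjoin_elementary {P : Setoid E} [Fintype (infiniteBlocks P)]
    {D : ℕ} (hD : D ≠ 0)
    (hle : ∀ (j : ℕ) (A A' : Finset E), IsoOn L (A : Set E) A' → IsUniform P D j A' →
      ∀ B ∈ P.classes, ((A : Set E) ∩ B).ncard ≤ D)
    {T : ageAlgebra L E →ₐ[ℚ] MvPolynomial (infiniteBlocks P) ℚ}
    (hT : ∀ f, blockHom _ (T f) = restrictHom (⋃₀ infiniteBlocks P) f.1)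
    (i : infiniteBlocks P) :
    IsIntegral (Algebra.adjoin ℚ (Set.range fun j : Fin (infiniteBlocks P).ncard =>
      T (elementary L P D (j + 1)))) (X i : MvPolynomial (infiniteBlocks P) ℚ) := by
  classical
  have hdisj : (infiniteBlocks P).PairwiseDisjoint id :=
    pairwiseDisjoint_of_subset_classes (infiniteBlocks_subset_classes P)
  have hcoeff : ∀ (j : ℕ) (A : Finset E), (A : Set E) ⊆ ⋃₀ infiniteBlocks P →
      divCoeff (T (elementary L P D j)) (count _ A) = (elementary L P D j).1.coeff A := by
    intro j A hA
    have h := congrArg (fun f => f.coeff A) (hT (elementary L P D j))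
    simp only [coeff_blockHom hdisj, coeff_restrictHom, if_pos hA] at h
    exact h
  refine isIntegral_X_of_dominant hD ?_ _ ?_ ?_ i
  · rw [Set.fintypeCard_eq_ncard]
  · intro j a ha
    obtain ⟨A, hA, -, rfl⟩ := exists_count_eq (Set.Subset.refl (infiniteBlocks P)) ∅ a
    have h1 : divCoeff (T (elementary L P D (j + 1))) (count _ A) ≠ 0 :=
      mul_ne_zero (prod_factorial_ne_zero _) (mem_support_iff.mp ha)
    rw [hcoeff _ A hA, coeff_elementary] at h1
    have h2 : ∃ A' : Finset E, IsoOn L (A : Set E) A' ∧ IsUniform P D (j + 1) A' := by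
      by_contra h
      exact h1 (if_neg h)
    obtain ⟨A', hiso, hu⟩ := h2
    refine ⟨?_, fun B => hle _ A A' hiso hu B B.2.1⟩
    rw [sum_count hdisj hA, hiso.card_eq, hu.card_eq]
  · intro j a s hs ha
    obtain ⟨A, hA, -, rfl⟩ := exists_count_eq (Set.Subset.refl (infiniteBlocks P)) ∅ a
    have hu := isUniform_of_count hA s fun B => by convert ha B
    rw [hs] at hu
    have h1 := hcoeff (j + 1) A hA
    rw [coeff_elementary, if_pos ⟨A, IsoOn.refl L _, hu⟩] at h1
    intro h2
    rw [divCoeff, h2, mul_zero] at h1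
    exact zero_ne_one h1

theorem isIntegral_of_isIntegral_integralClosure {R A : Type*} [CommRing R] [CommRing A]
    [Algebra R A] {x : A} (hx : IsIntegral (integralClosure R A) x) : IsIntegral R x :=
  isIntegral_trans x hx

theorem isIntegral_of_isNilpotent {R A : Type*} [CommRing R] [CommRing A] [Algebra R A] {x : A}
    (hx : IsNilpotent x) : IsIntegral R x := by
  obtain ⟨n, hn⟩ := hx
  refine IsIntegral.of_pow (n := n + 1) (Nat.succ_pos n) ?_
  rw [pow_succ, hn, zero_mul]
  exact isIntegral_zero

theorem isNilpotent_blockSum {B : Set E} (hB : B.Finite) : IsNilpotent (blockSum B) := by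
  classical
  refine isNilpotent_of_coeff_eq_zero (X := Bᶜ) (by simpa using hB) fun A hA => ?_
  rw [coeff_blockSum, if_neg]
  rintro ⟨x, hx, rfl⟩
  exact hA (by simp) hx

variable {P : Setoid E} [Finite (Quotient P)]

/-- The sums of singletons are integral over the subalgebra generated by the elements
`elementary L P D (j + 1)`. -/
theorem isIntegral_blockSum {D : ℕ} (hP : IsMonomorphicDecomposition L P) (hD : D ≠ 0)
    (hle : ∀ (j : ℕ) (A A' : Finset E), IsoOn L (A : Set E) A' → IsUniform P D j A' →
      ∀ B ∈ P.classes, ((A : Set E) ∩ B).ncard ≤ D) {B : Set E} (hB : B ∈ P.classes) :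
    IsIntegral (symSubalgebra L P D) (blockSum B) := by
  classical
  by_cases hfin : B.Finite
  · exact isIntegral_of_isNilpotent (isNilpotent_blockSum hfin)
  have : Fintype (infiniteBlocks P) := (finite_infiniteBlocks P).fintype
  obtain ⟨T, hT⟩ := exists_algHom_mvPolynomial hP (Set.Subset.refl (infiniteBlocks P))
  let i : infiniteBlocks P := ⟨B, hB, hfin⟩
  have hi := isIntegral_X_adjoin_elementary hD hle hT i
  let C := integralClosure (symSubalgebra L P D) (SetAlgebra E)
  have hmem : ∀ p ∈ Algebra.adjoin ℚ (Set.range fun j : Fin (infiniteBlocks P).ncard =>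
      T (elementary L P D (j + 1))), blockHom _ p ∈ C := by
    intro p hp
    induction hp using Algebra.adjoin_induction with
    | mem p hp =>
      obtain ⟨j, rfl⟩ := hp
      let θ : symSubalgebra L P D :=
        ⟨elementary L P D (j + 1), Algebra.subset_adjoin ⟨j, rfl⟩⟩
      have h1 : θ.1.1 ∈ C := isIntegral_algebraMap (x := θ)
      -- Only sets meeting the finite complement of the infinite blocks survive in the difference,
      -- so it is nilpotent and hence integral. Thus `θ` may be replaced by its restriction, which
      -- is the image of a polynomial.
      have h2 : θ.1.1 - restrictHom (⋃₀ infiniteBlocks P) θ.1.1 ∈ C := by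
        refine isIntegral_of_isNilpotent (isNilpotent_of_coeff_eq_zero
          (finite_compl_sUnion_infiniteBlocks P) fun A hA => ?_)
        rw [sub_eq_add_neg, SetAlgebra.coeff_add, ← neg_one_smul ℚ, SetAlgebra.coeff_smul,
          coeff_restrictHom, if_pos hA]
        ring
      have h3 := sub_mem h1 h2
      rwa [sub_sub_cancel, ← hT] at h3
    | algebraMap c =>
      rw [AlgHom.commutes]
      exact isIntegral_algebraMap (x := algebraMap ℚ (symSubalgebra L P D) c)
    | add p q _ _ hp hq => rw [map_add]; exact add_mem hp hq
    | mul p q _ _ hp hq => rw [map_mul]; exact mul_mem hp hq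
  let f : Algebra.adjoin ℚ (Set.range fun j : Fin (infiniteBlocks P).ncard =>
      T (elementary L P D (j + 1))) →+* C :=
    ((blockHom (infiniteBlocks P)).toRingHom.comp (Subalgebra.val _).toRingHom).codRestrict C
      fun p => hmem p p.2
  have h1 : IsIntegral C (blockHom _ (X i)) :=
    IsIntegral.map_of_comp_eq f (blockHom (infiniteBlocks P)).toRingHom (by ext; rfl) hi
  have h2 : blockHom _ (X i) = blockSum B := aeval_X _ _
  rw [h2] at h1
  exact isIntegral_of_isIntegral_integralClosure h1

theorem finiteType_symSubalgebra (P : Setoid E) (D : ℕ) :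
    Algebra.FiniteType ℚ (symSubalgebra L P D) :=
  (symSubalgebra L P D).fg_iff_finiteType.mp
    (Subalgebra.fg_def.mpr ⟨_, Set.finite_range _, rfl⟩)

/-- Finitely many integral elements generate a finite module, and submodules of it are finite over a
Noetherian ring. It serves to descend from the algebra of block sums, which need not lie in the age
algebra. -/
theorem module_finite_of_mem_adjoin {R N A : Type*} [CommRing R] [IsNoetherianRing R] [CommRing A]
    [Algebra R A] [AddCommGroup N] [Module R N] (f : N →ₗ[R] A) (hf : Function.Injective f)
    {s : Set A} (hs : s.Finite) (hint : ∀ x ∈ s, IsIntegral R x)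
    (hmem : ∀ n, f n ∈ Algebra.adjoin R s) : Module.Finite R N := by
  have : Module.Finite R (Subalgebra.toSubmodule (Algebra.adjoin R s)) :=
    Module.Finite.iff_fg.mpr (fg_adjoin_of_finite hs hint)
  refine Module.Finite.of_injective
    (f.codRestrict (Subalgebra.toSubmodule (Algebra.adjoin R s)) hmem) fun x y hxy => ?_
  exact hf (congrArg Subtype.val hxy)

theorem module_finite_symSubalgebra {D : ℕ} (hP : IsMonomorphicDecomposition L P) (hD : D ≠ 0)
    (hle : ∀ (j : ℕ) (A A' : Finset E), IsoOn L (A : Set E) A' → IsUniform P D j A' →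
      ∀ B ∈ P.classes, ((A : Set E) ∩ B).ncard ≤ D) :
    Module.Finite (symSubalgebra L P D) (ageAlgebra L E) := by
  classical
  have := finiteType_symSubalgebra (L := L) P D
  have : IsNoetherianRing (symSubalgebra L P D) := Algebra.FiniteType.isNoetherianRing ℚ _
  have : Fintype P.classes := (finite_classes P).fintype
  let M := Algebra.adjoin (symSubalgebra L P D) (blockSum '' P.classes)
  have hmem : ∀ f : ageAlgebra L E, f.1 ∈ M := by
    intro f
    -- Here all blocks are used, finite ones included, so nothing of `f` is lost; the polynomial
    -- need not be unique.
    obtain ⟨p, hp⟩ := exists_blockHom_eq_shift hP (Set.Subset.refl P.classes) (U := ∅) (by simp) f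
    have h1 : shift (⋃₀ P.classes) ∅ f.1 = f.1 := by
      ext A
      rw [coeff_shift, Finset.union_empty, if_pos]
      rw [Setoid.sUnion_classes]
      exact Set.subset_univ _
    rw [h1] at hp
    rw [← hp]
    clear hp h1
    induction p using MvPolynomial.induction_on with
    | C c =>
      rw [← algebraMap_eq, AlgHom.commutes]
      exact M.algebraMap_mem (algebraMap ℚ (symSubalgebra L P D) c)
    | add p q hp hq => rw [map_add]; exact add_mem hp hq
    | mul_X p B hp =>
      rw [map_mul]
      refine mul_mem hp ?_
      have : blockHom P.classes (X B) = blockSum B.1 := aeval_X _ _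
      rw [this]
      exact Algebra.subset_adjoin ⟨B, B.2, rfl⟩
  refine module_finite_of_mem_adjoin
    (IsScalarTower.toAlgHom (symSubalgebra L P D) (ageAlgebra L E) (SetAlgebra E)).toLinearMap
    Subtype.val_injective ((finite_classes P).image _) ?_ hmem
  rintro _ ⟨B, hB, rfl⟩
  exact isIntegral_blockSum hP hD hle hB

theorem algebraicIndependent_elementary {D : ℕ} (hP : IsMonomorphicDecomposition L P) (hD : D ≠ 0)
    (hle : ∀ (j : ℕ) (A A' : Finset E), IsoOn L (A : Set E) A' → IsUniform P D j A' →
      ∀ B ∈ P.classes, ((A : Set E) ∩ B).ncard ≤ D) :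
    AlgebraicIndependent ℚ fun j : Fin (infiniteBlocks P).ncard => elementary L P D (j + 1) := by
  have : Fintype (infiniteBlocks P) := (finite_infiniteBlocks P).fintype
  obtain ⟨T, hT⟩ := exists_algHom_mvPolynomial hP (Set.Subset.refl (infiniteBlocks P))
  refine AlgebraicIndependent.of_comp T ?_
  refine algebraicIndependent_of_isIntegral_X (Set.fintypeCard_eq_ncard _).symm _ fun i => ?_
  exact isIntegral_X_adjoin_elementary hD hle hT i

end Sufficiency

/-! ### Finite generation implies recursive minimality -/

section Necessity

variable {L : FirstOrder.Language.{u, v}} [L.IsRelational] {E : Type w} [L.Structure E]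

open Classical in
variable (L) in
/-- The sum of the sets isomorphic to a given one. -/
def orbitSum (Z : Finset E) : ageAlgebra L E :=
  ⟨fun A => if IsoOn L (A : Set E) Z then 1 else 0, by
    refine ⟨⟨Z.card, fun A hA => ?_⟩, fun A A' h => ?_⟩
    · by_contra hlt
      exact hA (if_neg fun h => hlt h.card_eq.le)
    · exact if_congr ⟨fun h' => h.symm.trans L h', fun h' => h.trans L h'⟩ rfl rfl⟩

open Classical in
theorem coeff_orbitSum (Z A : Finset E) :
    (orbitSum L Z).1.coeff A = if IsoOn L (A : Set E) Z then 1 else 0 := rfl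

variable (L E) in
/-- The sum of all singletons. -/
def singletonSum : ageAlgebra L E :=
  ⟨fun A => if A.card = 1 then 1 else 0, by
    refine ⟨⟨1, fun A hA => ?_⟩, fun A A' h => ?_⟩
    · by_contra hlt
      exact hA (if_neg (by omega))
    · exact if_congr (by rw [h.card_eq]) rfl rfl⟩

theorem coeff_singletonSum (A : Finset E) :
    (singletonSum L E).1.coeff A = if A.card = 1 then 1 else 0 := rfl

/-- A family of additive functionals which behaves like the components of a product indexed by the
subsets of a set; the derivation vanishes on all proper components. -/
theorem derivation_component_mul {A R : Type*} [CommRing A] [CommRing R] [Algebra ℚ R]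
    (δ : Derivation ℚ R R) {T : Finset E → A → R} {U : Finset E}
    (hmul : open Classical in ∀ f g, T U (f * g) = ∑ V ∈ U.powerset, T V f * T (U \ V) g)
    (hzero : ∀ V ⊂ U, ∀ f, δ (T V f) = 0) (f g : A) :
    δ (T U (f * g)) = T ∅ f * δ (T U g) + T ∅ g * δ (T U f) := by
  classical
  have h1 : ∑ V ∈ U.powerset, T V f * δ (T (U \ V) g) = T ∅ f * δ (T U g) := by
    rw [Finset.sum_eq_single ∅, Finset.sdiff_empty]
    · intro V hV hne
      rw [hzero (U \ V) (Finset.sdiff_ssubset (Finset.mem_powerset.mp hV)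
        (Finset.nonempty_iff_ne_empty.mpr hne)), mul_zero]
    · simp
  have h2 : ∑ V ∈ U.powerset, T (U \ V) g * δ (T V f) = T ∅ g * δ (T U f) := by
    rw [Finset.sum_eq_single U, Finset.sdiff_self]
    · intro V hV hne
      rw [hzero V (Finset.ssubset_iff_subset_ne.mpr ⟨Finset.mem_powerset.mp hV, hne⟩), mul_zero]
    · simp
  have hmul' : T U (f * g) = ∑ V ∈ U.powerset, T V f * T (U \ V) g := by
    convert hmul f g
  rw [hmul', map_sum]
  simp only [Derivation.leibniz, smul_eq_mul]
  rw [Finset.sum_add_distrib, h1, h2]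

/-- If the age algebra is finitely generated, then the minimal decomposition is recursively
minimal. -/
theorem isRecursivelyMinimal_of_finiteType {P : Setoid E} [Finite (Quotient P)]
    (hP : IsMinimalDecomposition L P) (hft : Algebra.FiniteType ℚ (ageAlgebra L E)) :
    IsRecursivelyMinimal L P := by
  classical
  by_contra hrec
  obtain ⟨S, hS, B, hB, C, hC, x, hx, y, hy, hxy, hint⟩ :=
    hP.exists_of_not_isRecursivelyMinimal hrec
  have hSc : S ⊆ P.classes := fun B hB => (hS hB).1
  have : Fintype S := ((finite_infiniteBlocks P).subset hS).fintype
  have hdisj : S.PairwiseDisjoint id := pairwiseDisjoint_of_subset_classes hSc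
  have hφ := blockHom_injective hS
  let b : S := ⟨B, hB⟩
  let c : S := ⟨C, hC⟩
  have hbc : b ≠ c := fun h => hxy (rel_of_mem_classes (hSc hC)
    ((show B = C from congrArg Subtype.val h) ▸ hx) hy)
  have hxX : x ∈ ⋃₀ S := ⟨B, hB, hx⟩
  have hyX : y ∈ ⋃₀ S := ⟨C, hC, hy⟩
  let δ := diffDeriv b c
  -- the components of the elements of the age algebra
  have hex : ∀ (U : Finset E) (f : ageAlgebra L E), ∃ p, (∀ z ∈ U, z ∉ ⋃₀ S) →
      blockHom S p = shift (⋃₀ S) U f.1 := by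
    intro U f
    by_cases hU : ∀ z ∈ U, z ∉ ⋃₀ S
    · obtain ⟨p, hp⟩ := exists_blockHom_eq_shift hP.1 hSc hU f
      exact ⟨p, fun _ => hp⟩
    · exact ⟨0, fun h => absurd h hU⟩
  choose T hT using hex
  have hTadd : ∀ U : Finset E, (∀ z ∈ U, z ∉ ⋃₀ S) → ∀ f g, T U (f + g) = T U f + T U g := by
    intro U hU f g
    apply hφ
    rw [map_add, hT U _ hU, hT U _ hU, hT U _ hU]
    exact map_add _ _ _
  have hTmul : ∀ U : Finset E, (∀ z ∈ U, z ∉ ⋃₀ S) → ∀ f g,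
      T U (f * g) = ∑ V ∈ U.powerset, T V f * T (U \ V) g := by
    intro U hU f g
    apply hφ
    rw [map_sum, hT U _ hU]
    refine (shift_mul hU f.1 g.1).trans (Finset.sum_congr rfl fun V hV => ?_)
    rw [map_mul, hT V f fun z hz => hU z (Finset.mem_powerset.mp hV hz),
      hT (U \ V) g fun z hz => hU z (Finset.sdiff_subset hz)]
  have hcoeff : ∀ U : Finset E, (∀ z ∈ U, z ∉ ⋃₀ S) → ∀ (f : ageAlgebra L E) (A : Finset E),
      (A : Set E) ⊆ ⋃₀ S → divCoeff (T U f) (count S A) = f.1.coeff (A ∪ U) := by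
    intro U hU f A hA
    have h := congrArg (fun f => f.coeff A) (hT U f hU)
    simp only [coeff_blockHom hdisj, coeff_shift, if_pos hA] at h
    exact h
  have hδcoeff : ∀ U : Finset E, (∀ z ∈ U, z ∉ ⋃₀ S) → ∀ (f : ageAlgebra L E) (A : Finset E),
      (A : Set E) ⊆ ⋃₀ S → x ∉ A → y ∉ A → divCoeff (δ (T U f)) (count S A) =
        f.1.coeff (insert x A ∪ U) - f.1.coeff (insert y A ∪ U) := by
    intro U hU f A hA hxA hyA
    rw [divCoeff_diffDeriv, ← count_insert hdisj hxA hx, ← count_insert hdisj hyA hy, hcoeff U hU,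
      hcoeff U hU]
    · rw [Finset.coe_insert]; exact Set.insert_subset hyX hA
    · rw [Finset.coe_insert]; exact Set.insert_subset hxX hA
  have hδzero : ∀ U : Finset E, (∀ z ∈ U, z ∉ ⋃₀ S) → ∀ f : ageAlgebra L E,
      (∀ A : Finset E, (A : Set E) ⊆ ⋃₀ S → x ∉ A → y ∉ A →
        f.1.coeff (insert x A ∪ U) = f.1.coeff (insert y A ∪ U)) → δ (T U f) = 0 := by
    intro U hU f h
    by_contra hne
    obtain ⟨a, ha⟩ := exists_divCoeff_ne_zero hne
    -- The blocks are infinite, so each exponent vector is realized by a set avoiding `x` and `y`,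
    -- to which either can be added.
    obtain ⟨A, hA, hAF, rfl⟩ := exists_count_eq hS {x, y} a
    have hxA : x ∉ A := fun h => Finset.disjoint_left.mp hAF h (by simp)
    have hyA : y ∉ A := fun h => Finset.disjoint_left.mp hAF h (by simp)
    exact ha (by rw [hδcoeff U hU f A hA hxA hyA, h A hA hxA hyA, sub_self])
  have hδempty : ∀ f, δ (T ∅ f) = 0 := by
    intro f
    refine hδzero ∅ (by simp) f fun A hA hxA hyA => ?_
    rw [Finset.union_empty, Finset.union_empty]
    refine f.2.2 _ _ ?_
    rw [Finset.coe_insert, Finset.coe_insert]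
    exact hint A hA hxA hyA
  -- a minimal component on which the derivation does not vanish
  have hexU : {U : Finset E | (∀ z ∈ U, z ∉ ⋃₀ S) ∧ ∃ f, δ (T U f) ≠ 0}.Nonempty := by
    have hni : ¬ Interchangeable L x y := fun h =>
      hxy (hP.2 _ (isMonomorphicDecomposition_interchangeSetoid L E) h)
    unfold Interchangeable at hni
    push Not at hni
    obtain ⟨W, hxW, hyW, hW⟩ := hni
    have hU : ∀ z ∈ W.filter (· ∉ ⋃₀ S), z ∉ ⋃₀ S := fun z hz => (Finset.mem_filter.mp hz).2
    -- A set `W` over which `x` and `y` cannot be exchanged is split into its part outside `⋃₀ S`,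
    -- taken as `U`, and its part inside, taken as `A`.
    refine ⟨W.filter (· ∉ ⋃₀ S), hU, orbitSum L (insert x W), fun h0 => ?_⟩
    have h1 := hδcoeff _ hU (orbitSum L (insert x W)) (W.filter (· ∈ ⋃₀ S))
      (fun z hz => (Finset.mem_filter.mp hz).2) (fun h => hxW (Finset.mem_filter.mp h).1)
      (fun h => hyW (Finset.mem_filter.mp h).1)
    rw [h0, Finset.insert_union, Finset.insert_union, Finset.filter_union_filter_not_eq,
      coeff_orbitSum, coeff_orbitSum, if_pos (IsoOn.refl L _), if_neg] at h1
    · simp [divCoeff] at h1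
    · rw [Finset.coe_insert, Finset.coe_insert]
      exact fun h => hW (h.symm)
  obtain ⟨U, ⟨hU, f₀, hf₀⟩, hmin⟩ := wellFounded_lt.has_min _ hexU
  have hzero : ∀ V ⊂ U, ∀ f, δ (T V f) = 0 := by
    intro V hV f
    by_contra hne
    exact hmin V ⟨fun z hz => hU z (hV.1 hz), f, hne⟩ hV
  have hδmul : ∀ f g, δ (T U (f * g)) = T ∅ f * δ (T U g) + T ∅ g * δ (T U f) := fun f g =>
    derivation_component_mul δ (fun f g => by convert hTmul U hU f g) hzero f g
  -- finite generation bounds the nilpotency index of the derivation on this component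
  obtain ⟨N, hN⟩ : ∃ N, ∀ f, δ^[N] (δ (T U f)) = 0 := by
    obtain ⟨s, hs⟩ := hft.out
    choose n hn using fun f => exists_diffDeriv_iterate_eq_zero (δ (T U f)) b c
    refine ⟨s.sup n, fun f => ?_⟩
    have hf : f ∈ Algebra.adjoin ℚ (s : Set (ageAlgebra L E)) := by rw [hs]; trivial
    induction hf using Algebra.adjoin_induction with
    | mem f hf =>
      obtain ⟨k, hk⟩ := Nat.exists_eq_add_of_le (Finset.le_sup (f := n) hf)
      rw [hk, add_comm, Function.iterate_add_apply]
      change δ^[k] ((diffDeriv b c)^[n f] (δ (T U f))) = 0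
      rw [hn f]
      exact Function.iterate_fixed (map_zero δ) k
    | algebraMap r =>
      rw [hδzero U hU, Function.iterate_fixed (map_zero δ)]
      intro A _ _ _
      rw [Algebra.algebraMap_eq_smul_one]
      change r * (1 : SetAlgebra E).coeff _ = r * (1 : SetAlgebra E).coeff _
      rw [SetAlgebra.coeff_one, SetAlgebra.coeff_one, if_neg, if_neg]
      · exact Finset.ne_empty_of_mem (a := y) (by simp)
      · exact Finset.ne_empty_of_mem (a := x) (by simp)
    | add f g _ _ hf hg =>
      rw [hTadd U hU, map_add, iterate_map_add, hf, hg, add_zero]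
    | mul f g _ _ hf hg =>
      -- The factors `T ∅ f` and `T ∅ g` are constants for `δ`, so products keep the bound `N` valid
      -- for the generators.
      rw [hδmul, iterate_map_add]
      change (diffDeriv b c)^[_] _ + (diffDeriv b c)^[_] _ = 0
      rw [diffDeriv_iterate_mul (hδempty f), diffDeriv_iterate_mul (hδempty g)]
      change _ * δ^[_] _ + _ * δ^[_] _ = 0
      rw [hf, hg, mul_zero, mul_zero, add_zero]
  -- a set of which the isomorphism type changes along a long line
  obtain ⟨h, a, ha, hab⟩ : ∃ h : ageAlgebra L E, ∃ a : S →₀ ℕ,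
      divCoeff (δ (T U h)) a ≠ 0 ∧ 2 * (N + 1) ≤ a b := by
    -- The coefficients of `e` depend only on cardinality, so `δ (T U e) = 0`. Hence multiplying
    -- `f₀` by a power of `e` multiplies `δ (T U f₀)` by the power of `T ∅ e`, which involves the
    -- variable `b` and so raises the degree in `b`.
    let e := singletonSum L E
    have hδe : δ (T U e) = 0 := by
      refine hδzero U hU e fun A hA hxA hyA => ?_
      have hxU : x ∉ U := fun h => hU x h hxX
      have hyU : y ∉ U := fun h => hU y h hyX
      rw [coeff_singletonSum, coeff_singletonSum, Finset.insert_union, Finset.insert_union,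
        Finset.card_insert_of_notMem (by simp [hxA, hxU]),
        Finset.card_insert_of_notMem (by simp [hyA, hyU])]
    have hT1 : T ∅ 1 = 1 := by
      apply hφ
      rw [hT ∅ 1 (by simp), map_one]
      exact map_one (restrictHom (⋃₀ S))
    have hTe : ∀ n : ℕ, T ∅ (e ^ n) = T ∅ e ^ n := by
      intro n
      induction n with
      | zero => rw [pow_zero, pow_zero, hT1]
      | succ n ih => rw [pow_succ, pow_succ, hTmul ∅ (by simp)]; simp [ih]
    have hδe' : ∀ n : ℕ, δ (T U (e ^ (n + 1))) = 0 := by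
      intro n
      induction n with
      | zero => rw [zero_add, pow_one, hδe]
      | succ n ih => rw [pow_succ, hδmul, ih, hδe, mul_zero, mul_zero, add_zero]
    have hcoe : divCoeff (T ∅ e) (Finsupp.single b 1) ≠ 0 := by
      have h1 : count S {x} = Finsupp.single b 1 := by
        have := count_insert hdisj (A := ∅) (x := x) (by simp) (B := b) hx
        rwa [count_empty, zero_add] at this
      rw [← h1, hcoeff ∅ (by simp) e {x} (by simpa using hxX), coeff_singletonSum]
      simp
    have hcoe' : coeff (Finsupp.single b 1) (T ∅ e) ≠ 0 := right_ne_zero_of_mul hcoe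
    have he0 : T ∅ e ≠ 0 := fun h => hcoe' (by rw [h, coeff_zero])
    have hdeg : 1 ≤ degreeOf b (T ∅ e) := by
      have := monomial_le_degreeOf b (mem_support_iff.mpr hcoe')
      rwa [Finsupp.single_eq_same] at this
    have hδh : δ (T U (f₀ * e ^ (2 * N + 1 + 1))) = T ∅ e ^ (2 * N + 1 + 1) * δ (T U f₀) := by
      rw [hδmul, hδe', mul_zero, zero_add, hTe]
    have hdeg' : 2 * (N + 1) ≤ degreeOf b (δ (T U (f₀ * e ^ (2 * N + 1 + 1)))) := by
      rw [hδh, degreeOf_mul_eq (pow_ne_zero _ he0) hf₀, degreeOf_pow_eq _ _ _ he0]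
      nlinarith
    obtain ⟨a, ha, hab⟩ : ∃ a ∈ (δ (T U (f₀ * e ^ (2 * N + 1 + 1)))).support,
        2 * (N + 1) ≤ a b := by
      by_contra! hcon
      have := (degreeOf_lt_iff (by omega)).mpr hcon
      omega
    exact ⟨_, a, mul_ne_zero (prod_factorial_ne_zero _) (mem_support_iff.mp ha), hab⟩
  rw [divCoeff_diffDeriv] at ha
  obtain ⟨A₁, hA₁, -, hcount₁⟩ := exists_count_eq hS ∅ (a + Finsupp.single b 1)
  obtain ⟨A₂, hA₂, -, hcount₂⟩ := exists_count_eq hS ∅ (a + Finsupp.single c 1)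
  have hniso : ¬ IsoOn L ((A₂ ∪ U : Finset E) : Set E) ((A₁ ∪ U : Finset E) : Set E) := by
    intro hiso
    refine ha ?_
    rw [← hcount₁, ← hcount₂, hcoeff U hU h A₁ hA₁, hcoeff U hU h A₂ hA₂, h.2.2 _ _ hiso, sub_self]
  -- The nonzero coefficient at `a` shows that `A₁ ∪ U` and `A₂ ∪ U` are not isomorphic; the orbit
  -- sum of the first has `0`-`1` coefficients that separate them.
  let q := T U (orbitSum L (A₁ ∪ U))
  have hq01 : ∀ a, divCoeff q a = 0 ∨ divCoeff q a = 1 := by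
    intro a
    obtain ⟨A, hA, -, rfl⟩ := exists_count_eq hS ∅ a
    rw [hcoeff U hU _ A hA, coeff_orbitSum]
    split_ifs
    · exact Or.inr rfl
    · exact Or.inl rfl
  have hq₁ : divCoeff q (a + Finsupp.single b 1) = 1 := by
    rw [← hcount₁, hcoeff U hU _ A₁ hA₁, coeff_orbitSum, if_pos (IsoOn.refl L _)]
  have hq₂ : divCoeff q (a + Finsupp.single c 1) = 0 := by
    rw [← hcount₂, hcoeff U hU _ A₂ hA₂, coeff_orbitSum, if_neg hniso]
  let a₀ : S →₀ ℕ := (a.erase b).erase c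
  have ha₀ : a = a₀ + Finsupp.single b (a b) + Finsupp.single c (a c) := by
    ext d
    simp only [a₀, Finsupp.add_apply]
    by_cases hdc : d = c
    · subst hdc
      simp [hbc]
    · by_cases hdb : d = b
      · subst hdb
        simp [hdc]
      · simp [Finsupp.erase_ne hdc, Finsupp.erase_ne hdb, Finsupp.single_eq_of_ne hdc,
          Finsupp.single_eq_of_ne hdb]
  -- The line of vectors that agree with `a` off `b` and `c` and have total `m` there. The count
  -- vectors of `A₂` and `A₁` are its consecutive points `a b` and `a b + 1`, and `2 * (N + 1) ≤ a
  -- b` makes it long enough.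
  let m := a b + a c + 1
  let g : ℕ → ℚ := fun i => divCoeff q (a₀ + Finsupp.single b i + Finsupp.single c (m - i))
  have hg : g (a b) = g (a b + 1) := by
    refine eq_succ_of_fwdDiff_iter_eq_zero (g := g) (m := m) (N := N + 1) (by omega) (fun i _ => hq01 _)
      (fun i hi => ?_) (show a b < a b + a c + 1 by omega)
    rw [← divCoeff_diffDeriv_iterate q b c a₀ m (N + 1) i (m - (N + 1) - i) (by omega),
      Function.iterate_succ_apply]
    have := hN (orbitSum L (A₁ ∪ U))
    change divCoeff (δ^[N] (δ q)) _ = 0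
    rw [this]
    simp [divCoeff]
  have hg₁ : g (a b + 1) = 1 := by
    rw [← hq₁]
    simp only [g, m]
    rw [show a b + a c + 1 - (a b + 1) = a c by omega]
    conv_rhs => rw [ha₀]
    rw [Finsupp.single_add]
    congr 1
    abel
  have hg₂ : g (a b) = 0 := by
    rw [← hq₂]
    simp only [g, m]
    rw [show a b + a c + 1 - a b = a c + 1 by omega]
    conv_rhs => rw [ha₀]
    rw [Finsupp.single_add, add_assoc]
    congr 1
    abel
  rw [hg₁, hg₂] at hg
  exact zero_ne_one hg

end Necessity

end AgeAlg

end

/-! ### The theorem -/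

theorem mainTheorem8 (L : FirstOrder.Language) [L.IsRelational] (E : Type*) [L.Structure E]
    (hE : ∃ Q : Setoid E, AgeAlg.IsMonomorphicDecomposition L Q ∧ Finite (Quotient Q)) :
    ∃ P : Setoid E, AgeAlg.IsMinimalDecomposition L P ∧ Finite (Quotient P) ∧
      (Algebra.FiniteType ℚ (AgeAlg.ageAlgebra L E) ↔ AgeAlg.IsRecursivelyMinimal L P) ∧
      (Algebra.FiniteType ℚ (AgeAlg.ageAlgebra L E) →
        ∃ D : ℕ, 1 ≤ D ∧
          AlgebraicIndependent ℚ (fun j : Fin (AgeAlg.infiniteBlocks P).ncard =>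
            AgeAlg.elementary L P D (j + 1)) ∧
          Module.Finite (AgeAlg.symSubalgebra L P D) (AgeAlg.ageAlgebra L E)) := by
  obtain ⟨Q, hQ, hfin⟩ := hE
  have hP := AgeAlg.isMinimalDecomposition_interchangeSetoid L E
  have hfinP : Finite (Quotient (AgeAlg.interchangeSetoid L E)) :=
    Finite.of_surjective (Quotient.map' (s₁ := Q) (s₂ := AgeAlg.interchangeSetoid L E) id
      (fun _ _ h => hP.2 Q hQ h)) (by rintro ⟨x⟩; exact ⟨Quotient.mk Q x, rfl⟩)
  have key : AgeAlg.IsRecursivelyMinimal L (AgeAlg.interchangeSetoid L E) → ∃ D : ℕ, 1 ≤ D ∧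
      AlgebraicIndependent ℚ
        (fun j : Fin (AgeAlg.infiniteBlocks (AgeAlg.interchangeSetoid L E)).ncard =>
          AgeAlg.elementary L (AgeAlg.interchangeSetoid L E) D (j + 1)) ∧
      Module.Finite (AgeAlg.symSubalgebra L (AgeAlg.interchangeSetoid L E) D)
        (AgeAlg.ageAlgebra L E) := by
    intro hrec
    obtain ⟨D, hD, hle⟩ := hrec.exists_ncard_inter_le
    exact ⟨D, hD, AgeAlg.algebraicIndependent_elementary hP.1 (by omega) hle,
      AgeAlg.module_finite_symSubalgebra hP.1 (by omega) hle⟩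
  refine ⟨AgeAlg.interchangeSetoid L E, hP, hfinP,
    ⟨AgeAlg.isRecursivelyMinimal_of_finiteType hP, fun hrec => ?_⟩,
    fun hft => key (AgeAlg.isRecursivelyMinimal_of_finiteType hP hft)⟩
  -- A finite module over a finitely generated algebra is a finitely generated algebra.
  obtain ⟨D, -, -, hmod⟩ := key hrec
  have := AgeAlg.finiteType_symSubalgebra (L := L) (AgeAlg.interchangeSetoid L E) D
  exact Algebra.FiniteType.trans this inferInstance
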